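/- For $K\ge 0$, the biased graph process $G_K$ on $n$ vertices is the random sequence of graphs $G_K^0,G_K^1,\dots$ in which $G_K^0$ is edgeless and $G_K^{m}$ arises from $G_K^{m-1}$ by adding one missing edge, chosen with probability proportional to its weight: a missing edge has weight $1$ if both its endpoints are isolated in $G_K^{m-1}$ and weight $K$ otherwise; once there are fewer than two isolated vertices, all missing edges have equal weight; a complete graph stays unchanged. Put $G_K(t)=G_K^{\lfloor tn/2\rfloor}$, and let $I(G)$ be the fraction of vertices of $G$ that are isolated. Theorem. For every $K>0$ the initial value problem $$y'=\frac{(1-y)K}{y^2+(1-y^2)K}-1,\qquad y(0)=1$$ has a unique solution $y$ on $[0,\infty)$, and for every $C>0$ there is a constant $A=A(K,C)$ such that, with probability tending to $1$ as $n\to\infty$, $$|I(G_K(t))-y(t)|\le A\,n^{-1/4}\quad\text{for all } t\in[0,C].$$ For $K=0$ the same holds on $[0,1]$: the initial value problem has a unique solution $y$ that is continuous on $[0,1]$ and satisfies the equation on $[0,1)$, and there is a constant $A$ such that, with probability tending to $1$, $|I(G_0(t))-y(t)|\le A\,n^{-1/4}$ for all $t\in[0,1]$. -/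

import Mathlib

open Set Filter Topology MeasureTheory ProbabilityTheory
open scoped ENNReal NNReal

noncomputable section

namespace BiasedProcess

/-- The set of isolated vertices of a graph. -/
def isolatedSet {V : Type*} (G : SimpleGraph V) : Set V := {v | G.IsIsolated v}

/-- The fraction `I(G)` of isolated vertices of a graph on `n` vertices. -/
def isolatedFraction {n : ℕ} (G : SimpleGraph (Fin n)) : ℝ := (isolatedSet G).ncard / n

/-- The missing edges of `G`: unordered pairs of distinct vertices that are not adjacent. -/
def missingEdges {V : Type*} (G : SimpleGraph V) : Set (Sym2 V) := Gᶜ.edgeSet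

open Classical in
/-- The weight of a pair as the next edge. Only missing edges get a positive weight. If there are
at least two isolated vertices, a missing edge has weight `1` if both its endpoints are isolated and
weight `K` otherwise; if there are fewer than two, all missing edges have weight `1`. -/
def edgeWeight {n : ℕ} (K : ℝ≥0) (G : SimpleGraph (Fin n)) (e : Sym2 (Fin n)) : ℝ≥0∞ :=
  if e ∈ missingEdges G then
    if 2 ≤ (isolatedSet G).ncard ∧ ¬ (∀ v ∈ e, G.IsIsolated v) then (K : ℝ≥0∞) else 1
  else 0

lemma tsum_edgeWeight_ne_zero {n : ℕ} (K : ℝ≥0) {G : SimpleGraph (Fin n)} (hG : G ≠ ⊤) :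
    ∑' e, edgeWeight K G e ≠ 0 := by
  rw [Ne, ENNReal.tsum_eq_zero]
  intro h
  by_cases hi : 2 ≤ (isolatedSet G).ncard
  · obtain ⟨u, v, hu, hv, huv⟩ := (Set.one_lt_ncard_iff (Set.toFinite _)).1 hi
    have h1 : s(u, v) ∈ missingEdges G := by
      simp only [missingEdges, SimpleGraph.mem_edgeSet, SimpleGraph.compl_adj]
      exact ⟨huv, hu v⟩
    have h2 : ∀ w ∈ s(u, v), G.IsIsolated w := by
      intro w hw
      rcases Sym2.mem_iff.1 hw with rfl | rfl
      exacts [hu, hv]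
    have h3 := h s(u, v)
    rw [edgeWeight, if_pos h1, if_neg (fun h4 => h4.2 h2)] at h3
    exact one_ne_zero h3
  · obtain ⟨u, v, huv, hn⟩ : ∃ u v, u ≠ v ∧ ¬ G.Adj u v := by
      by_contra! hc
      exact hG (SimpleGraph.ext (by
        ext u v
        exact ⟨fun h => h.ne, fun h => hc u v h⟩))
    have h1 : s(u, v) ∈ missingEdges G := by
      simp only [missingEdges, SimpleGraph.mem_edgeSet, SimpleGraph.compl_adj]
      exact ⟨huv, hn⟩
    have h3 := h s(u, v)
    rw [edgeWeight, if_pos h1, if_neg (fun h4 => hi h4.1)] at h3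
    exact one_ne_zero h3

lemma tsum_edgeWeight_ne_top {n : ℕ} (K : ℝ≥0) (G : SimpleGraph (Fin n)) :
    ∑' e, edgeWeight K G e ≠ ∞ := by
  rw [tsum_fintype]
  refine ENNReal.sum_ne_top.2 fun e _ => ?_
  unfold edgeWeight
  split_ifs <;> simp

open Classical in
/-- The law of the next graph of the biased process when the present graph is `G`: one missing edge
is added, chosen with probability proportional to its weight; the complete graph stays put. -/
def stepLaw {n : ℕ} (K : ℝ≥0) (G : SimpleGraph (Fin n)) : PMF (SimpleGraph (Fin n)) :=
  if hG : G = ⊤ then PMF.pure ⊤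
  else (PMF.normalize (edgeWeight K G) (tsum_edgeWeight_ne_zero K hG)
    (tsum_edgeWeight_ne_top K G)).map (fun e => G ⊔ SimpleGraph.fromEdgeSet {e})

instance instMeasurableSingletonClassGraph {n : ℕ} :
    MeasurableSingletonClass (SimpleGraph (Fin n)) where
  measurableSet_singleton G := by
    have h : ({G} : Set (SimpleGraph (Fin n))) =
        ⋂ u, ⋂ v, {H : SimpleGraph (Fin n) | H.Adj u v ↔ G.Adj u v} := by
      ext H
      simp only [mem_singleton_iff, mem_iInter, mem_ofPred_eq]
      refine ⟨fun h u v => by rw [h], fun h => SimpleGraph.ext (by ext u v; exact h u v)⟩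
    rw [h]
    refine MeasurableSet.iInter fun u => MeasurableSet.iInter fun v => ?_
    have hm : Measurable fun H : SimpleGraph (Fin n) => H.Adj u v :=
      SimpleGraph.measurable_iff_adj.1 measurable_id u v
    exact measurableSet_setOfPred.2 (hm.iff measurable_const)

/-- The transition kernel from the history up to step `m` to the graph after step `m + 1`; it depends
on the history only through its last graph. -/
def stepKernel {n : ℕ} (K : ℝ≥0) (m : ℕ) :
    Kernel ((_i : Finset.Iic m) → SimpleGraph (Fin n)) (SimpleGraph (Fin n)) :=
  Kernel.ofFunOfCountable fun h => (stepLaw K (h ⟨m, Finset.mem_Iic.2 le_rfl⟩)).toMeasure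

instance instIsMarkovKernelStep {n : ℕ} (K : ℝ≥0) (m : ℕ) :
    IsMarkovKernel (stepKernel (n := n) K m) :=
  ⟨fun h => PMF.toMeasure.isProbabilityMeasure
    (stepLaw K (h ⟨m, Finset.mem_Iic.2 le_rfl⟩))⟩

/-- The biased graph process on `n` vertices with parameter `K`: the law of the whole sequence
`G^0, G^1, G^2, …` of graphs, started from the edgeless graph. -/
def processLaw (n : ℕ) (K : ℝ≥0) : Measure (ℕ → SimpleGraph (Fin n)) :=
  Kernel.trajMeasure (X := fun _ => SimpleGraph (Fin n)) (Measure.dirac ⊥) (stepKernel K)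

/-- The rescaled process `G(t) = G^{⌊t n / 2⌋}`. -/
def atTime {n : ℕ} (ω : ℕ → SimpleGraph (Fin n)) (t : ℝ) : SimpleGraph (Fin n) :=
  ω ⌊t * n / 2⌋₊

/-- `y` solves `y' = (1 - y) K / (y² + (1 - y²) K) - 1`, `y(0) = 1` on `[0, T]`: it is continuous
there, and the equation holds, with a nonzero denominator, on `[0, T)`. -/
structure IsSolution (K T : ℝ) (y : ℝ → ℝ) : Prop where
  init : y 0 = 1
  cont : ContinuousOn y (Icc 0 T)
  denom_ne_zero : ∀ t ∈ Ico 0 T, y t ^ 2 + (1 - y t ^ 2) * K ≠ 0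
  deriv : ∀ t ∈ Ico 0 T, HasDerivWithinAt y
    ((1 - y t) * K / (y t ^ 2 + (1 - y t ^ 2) * K) - 1) (Icc 0 T) t

/-- `y` is the solution on `[0, T]`, unique there. -/
def IsUniqueSolution (K T : ℝ) (y : ℝ → ℝ) : Prop :=
  IsSolution K T y ∧ ∀ u, IsSolution K T u → EqOn u y (Icc 0 T)

/-- There is a constant `A` (not depending on `n` or `t`) such that the probability that
`|I(G(t)) - y(t)| ≤ A n^{-1/4}` for all `t ∈ [0, C]` tends to `1` as `n → ∞`. -/
def AlmostSurelyClose (K : ℝ≥0) (C : ℝ) (y : ℝ → ℝ) : Prop :=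
  ∃ A : ℝ, Tendsto (fun n : ℕ => processLaw n K
      {ω | ∀ t ∈ Icc 0 C, |isolatedFraction (atTime ω t) - y t| ≤ A * (n : ℝ) ^ (-(1 / 4) : ℝ)})
    atTop (𝓝 1)

end BiasedProcess

end

/-! The ODE side: on $[0,1]$ the denominator is at least $\min(1,K)$, so for $K>0$ the right-hand
side `rhs` is Lipschitz there. Clamping it to $[0,1]$ gives a global solution, barriers at $0$ and
$1$ show that the clamp is never active, and uniqueness is the Lipschitz argument on compact
subintervals.

The random side, for $K>0$, is a second-moment version of the differential equation method. If
$X=xn$ vertices are isolated, weighting each isolated vertex by the missing edges at it gives an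
expected drop $-2\,$`rhs`$(x)+O(1/n)$ of $X$ in one step (`exists_drift_bound`); the $O(n)$ edges
already present only affect the error. One step lasts time $2/n$, so the deviation $e_m$ from $y$
satisfies $E e_{m+1}^2\le(1+a/n)E e_m^2+b/n^2$ (`exists_one_step_bound`), whence $E e_m^2=O(1/n)$
over $O(n)$ steps (`exists_integral_sq_le`). Markov's inequality on a grid of $O(n^{1/4})$ steps
bounds all grid deviations by $n^{-1/4}$ outside an event of probability $O(n^{-1/4})$; between grid
points both the process and $y$ move by $O(n^{-1/4})$.

For $K=0$ every step removes exactly two isolated vertices, so only rounding remains. -/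

noncomputable section

namespace BiasedProcess

/-! ### The differential equation -/

/-- A bounded Lipschitz vector field on the line has a solution on all of `[0, ∞)`. -/
lemma exists_global_solution {g : ℝ → ℝ} {L : ℝ≥0} (hL : LipschitzWith L g) {B : ℝ≥0}
    (hB : ∀ x, |g x| ≤ B) (x₀ : ℝ) :
    ∃ y : ℝ → ℝ, y 0 = x₀ ∧ ∀ t, 0 ≤ t → HasDerivWithinAt y (g (y t)) (Ici 0) t := by
  have key : ∀ N : ℕ, ∃ α : ℝ → ℝ, α 0 = x₀ ∧
      ∀ t ∈ Icc (0 : ℝ) (N + 1), HasDerivWithinAt α (g (α t)) (Icc 0 (N + 1)) t := by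
    intro N
    have hN : (0 : ℝ) ≤ N + 1 := by positivity
    -- The radius `B * (N + 1)` is the farthest a curve of speed at most `B` gets by time `N + 1`,
    -- so Picard–Lindelöf covers the whole interval.
    have hpl : IsPicardLindelof (fun _ => g) (⟨0, left_mem_Icc.2 hN⟩ : Icc (0 : ℝ) (N + 1)) x₀
        (B * (N + 1)) 0 B L :=
      { lipschitzOnWith := fun t _ => hL.lipschitzOnWith
        continuousOn := fun x _ => continuousOn_const
        norm_le := fun t _ x _ => hB x
        mul_max_le := by simp [hN] }
    exact hpl.exists_eq_forall_mem_Icc_hasDerivWithinAt₀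
  choose α h0 hd using key
  have hright : ∀ N : ℕ, ∀ t ∈ Ico (0 : ℝ) (N + 1), HasDerivWithinAt (α N) (g (α N t)) (Ici t) t := by
    intro N t ht
    refine ((hd N t (Ico_subset_Icc_self ht)).mono
      (Icc_subset_Icc_left ht.1)).mono_of_mem_nhdsWithin ?_
    exact Icc_mem_nhdsGE ht.2
  have huniq : ∀ N M : ℕ, N ≤ M → EqOn (α N) (α M) (Icc 0 (N + 1)) := by
    intro N M hNM
    have hNM' : (N : ℝ) ≤ M := by exact_mod_cast hNM
    refine ODE_solution_unique_of_mem_Icc_right (v := fun _ => g) (s := fun _ => univ) (K := L)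
      (fun t _ => hL.lipschitzOnWith) (fun t ht => (hd N t ht).continuousWithinAt) (hright N)
      (fun _ _ => mem_univ _) (fun t ht => ?_) (fun t ht => hright M t ⟨ht.1, by linarith [ht.2]⟩)
      (fun _ _ => mem_univ _) (by rw [h0, h0])
    exact (hd M t ⟨ht.1, by linarith [ht.2]⟩).continuousWithinAt.mono
      (Icc_subset_Icc_right (by linarith))
  have hy : ∀ M : ℕ, ∀ s ∈ Ico (0 : ℝ) (M + 1), α ⌊s⌋₊ s = α M s := by
    intro M s hs
    have h1 : ⌊s⌋₊ ≤ M := by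
      have : ⌊s⌋₊ < M + 1 := (Nat.floor_lt hs.1).2 (by exact_mod_cast hs.2)
      omega
    exact huniq _ _ h1 ⟨hs.1, (Nat.lt_floor_add_one s).le⟩
  refine ⟨fun t => α ⌊t⌋₊ t, by simp [h0], fun t ht => ?_⟩
  have htM : t < (⌊t⌋₊ : ℝ) + 1 := Nat.lt_floor_add_one t
  have hmem : Ico (0 : ℝ) (⌊t⌋₊ + 1) ∈ 𝓝[Ici 0] t := by
    rw [← Ici_inter_Iio]
    exact inter_mem_nhdsWithin _ (Iio_mem_nhds htM)
  have h1 := (hd ⌊t⌋₊ t ⟨ht, htM.le⟩).mono_of_mem_nhdsWithin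
    (mem_of_superset hmem Ico_subset_Icc_self)
  exact h1.congr_of_eventuallyEq (mem_of_superset hmem (fun s hs => hy _ s hs)) rfl

/-- The denominator in the differential equation. -/
def denom (K y : ℝ) : ℝ := y ^ 2 + (1 - y ^ 2) * K

/-- The right-hand side of the differential equation. -/
def rhs (K y : ℝ) : ℝ := (1 - y) * K / denom K y - 1

/-- Cross-multiplying, the numerator of the difference contains the factor `b - a`. The domain is
not $[0,1]$ because uniqueness must cover competitors that leave it, and $K=0$, where the
denominator is $y^2$. -/
lemma rhs_lipschitzOnWith {K M δ : ℝ} (hK : 0 ≤ K) (hM : 0 ≤ M) (hδ : 0 < δ) :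
    ∃ L : ℝ≥0, LipschitzOnWith L (rhs K) {y | |y| ≤ M ∧ δ ≤ denom K y} := by
  have hc : 0 ≤ K * ((1 + K) * (2 * M + M * M) + K) / (δ * δ) := by positivity
  refine ⟨⟨_, hc⟩, LipschitzOnWith.of_dist_le_mul fun a ha b hb => ?_⟩
  obtain ⟨ha1, ha2⟩ := ha
  obtain ⟨hb1, hb2⟩ := hb
  have hDa : 0 < denom K a := hδ.trans_le ha2
  have hDb : 0 < denom K b := hδ.trans_le hb2
  have e1 : rhs K a - rhs K b =
      K * ((1 - K) * (a + b - a * b) + K) * (b - a) / (denom K a * denom K b) := by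
    rw [rhs, rhs, sub_sub_sub_cancel_right, div_sub_div _ _ hDa.ne' hDb.ne']
    congr 1
    simp only [denom]
    ring
  have h1 : |(1 - K) * (a + b - a * b) + K| ≤ (1 + K) * (2 * M + M * M) + K := by
    have h2 : |a + b - a * b| ≤ 2 * M + M * M := by
      calc |a + b - a * b| ≤ |a| + |b| + |a| * |b| := by
            rw [← abs_mul]
            exact (abs_sub _ _).trans (by gcongr; exact abs_add_le _ _)
        _ ≤ M + M + M * M := by gcongr
        _ = _ := by ring
    have h3 : |1 - K| ≤ 1 + K := by rw [abs_le]; constructor <;> linarith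
    calc _ ≤ |(1 - K) * (a + b - a * b)| + |K| := abs_add_le _ _
      _ ≤ _ := by rw [abs_mul, abs_of_nonneg hK]; gcongr
  rw [Real.dist_eq, Real.dist_eq, e1, abs_div, abs_mul, abs_mul, abs_of_nonneg hK,
    abs_of_pos (mul_pos hDa hDb), abs_sub_comm b a]
  change _ ≤ K * ((1 + K) * (2 * M + M * M) + K) / (δ * δ) * |a - b|
  rw [div_mul_eq_mul_div]
  gcongr

/-- The denominator is a convex combination of $1$ and $K$, with weights $y^2$ and $1-y^2$. -/
lemma min_le_denom {K y : ℝ} (h0 : 0 ≤ y) (h1 : y ≤ 1) : min 1 K ≤ denom K y := by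
  have hy : y ^ 2 ≤ 1 := by nlinarith
  rw [denom]
  nlinarith [min_le_left 1 K, min_le_right 1 K, sq_nonneg y]

lemma rhs_eq {K y : ℝ} (h : denom K y ≠ 0) :
    rhs K y = -(y ^ 2 + K * y * (1 - y)) / denom K y := by
  rw [rhs, eq_div_iff h, sub_mul, div_mul_cancel₀ _ h, denom]
  ring

lemma rhs_zero {K : ℝ} (hK : 0 < K) : rhs K 0 = 0 := by
  simp [rhs, denom, hK.ne']

lemma rhs_nonpos {K y : ℝ} (hK : 0 < K) (h0 : 0 ≤ y) (h1 : y ≤ 1) : rhs K y ≤ 0 := by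
  have hD : 0 < denom K y := (lt_min one_pos hK).trans_le (min_le_denom h0 h1)
  rw [rhs_eq hD.ne']
  refine div_nonpos_of_nonpos_of_nonneg ?_ hD.le
  have : 0 ≤ K * y * (1 - y) := mul_nonneg (by positivity) (by linarith)
  nlinarith

/-- The right-hand side is Lipschitz on the unit interval. -/
lemma exists_lipschitz_rhs {K : ℝ} (hK : 0 < K) :
    ∃ L : ℝ≥0, LipschitzOnWith L (rhs K) (Icc 0 1) := by
  obtain ⟨L, hL⟩ := rhs_lipschitzOnWith hK.le zero_le_one (lt_min one_pos hK)
  refine ⟨L, hL.mono fun y hy => ⟨abs_le.2 ⟨by linarith [hy.1], hy.2⟩, min_le_denom hy.1 hy.2⟩⟩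

/-- The solution of the initial value problem on `[0, ∞)`; it stays in the unit interval. -/
lemma exists_solution {K : ℝ} (hK : 0 < K) :
    ∃ y : ℝ → ℝ, y 0 = 1 ∧ (∀ t, 0 ≤ t → y t ∈ Icc (0 : ℝ) 1) ∧
      ∀ t, 0 ≤ t → HasDerivWithinAt y (rhs K (y t)) (Ici 0) t := by
  obtain ⟨L, hL⟩ := exists_lipschitz_rhs hK
  -- Clamping to the unit interval makes the field globally Lipschitz and bounded.
  set c : ℝ → ℝ := fun x => projIcc (0 : ℝ) 1 zero_le_one x with hc
  have hcm : ∀ x, c x ∈ Icc (0 : ℝ) 1 := fun x => (projIcc (0 : ℝ) 1 zero_le_one x).2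
  have hLc : LipschitzWith L (fun x => rhs K (c x)) := by
    refine LipschitzWith.of_dist_le_mul fun a b => ?_
    refine (hL.dist_le_mul _ (hcm a) _ (hcm b)).trans ?_
    gcongr
    have := (LipschitzWith.projIcc (zero_le_one (α := ℝ))).dist_le_mul a b
    simpa only [NNReal.coe_one, one_mul, Subtype.dist_eq] using this
  have hB : ∀ x, |rhs K (c x)| ≤ L := by
    intro x
    have h1 := hL.dist_le_mul _ (hcm x) 0 (by simp)
    rw [rhs_zero hK, Real.dist_eq, Real.dist_eq, sub_zero, sub_zero] at h1
    refine h1.trans (mul_le_of_le_one_right L.2 ?_)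
    rw [abs_of_nonneg (hcm x).1]
    exact (hcm x).2
  obtain ⟨y, hy0, hy⟩ := exists_global_solution hLc hB 1
  have hcont : ContinuousOn y (Ici 0) := fun t ht => (hy t ht).continuousWithinAt
  have hright : ∀ t, 0 ≤ t → HasDerivWithinAt y (rhs K (c (y t))) (Ici t) t :=
    fun t ht => (hy t ht).mono (Ici_subset_Ici.2 ht)
  have hle : ∀ t, 0 ≤ t → y t ≤ 1 := by
    intro t ht
    refine image_le_of_liminf_slope_right_le_deriv_boundary (f := y)
      (B := fun _ => 1) (B' := fun _ => 0) (a := 0) (b := t)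
      (hcont.mono Icc_subset_Ici_self) hy0.le continuousOn_const
      (fun x _ => hasDerivWithinAt_const _ _ _) ?_ ⟨ht, le_rfl⟩
    intro x hx r hr
    refine (hright x hx.1).liminf_right_slope_le ?_
    exact (rhs_nonpos hK (hcm _).1 (hcm _).2).trans_lt hr
  have hge : ∀ t, 0 ≤ t → 0 ≤ y t := by
    intro t ht
    -- The field vanishes at $0$, so $0$ is not a strict barrier; `-y` is compared with a line of
    -- slope `ε / (t + 1)`. At a contact point the clamped field is $0$, below that slope.
    refine le_of_forall_pos_le_add fun ε hε => ?_
    have h1 : -y t ≤ ε / (t + 1) * t := by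
      refine image_le_of_deriv_right_lt_deriv_boundary (f := fun s => -y s)
        (f' := fun s => -rhs K (c (y s))) (B := fun s => ε / (t + 1) * s)
        (B' := fun _ => ε / (t + 1)) (a := 0) (b := t)
        (hcont.mono Icc_subset_Ici_self).neg (fun x hx => (hright x hx.1).neg)
        (by simp [hy0]) (fun x => by simpa using (hasDerivAt_id x).const_mul (ε / (t + 1))) ?_
        ⟨ht, le_rfl⟩
      intro x hx hxe
      have h2 : y x ≤ 0 := by
        have : 0 ≤ ε / (t + 1) * x := mul_nonneg (by positivity) hx.1
        linarith
      have h3 : c (y x) = 0 := by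
        simp only [hc, projIcc_of_le_left zero_le_one h2]
      rw [h3, rhs_zero hK, neg_zero]
      positivity
    have h2 : ε / (t + 1) * t ≤ ε := by
      rw [div_mul_eq_mul_div, div_le_iff₀ (by positivity)]
      nlinarith
    linarith
  refine ⟨y, hy0, fun t ht => ⟨hge t ht, hle t ht⟩, fun t ht => ?_⟩
  have h1 : c (y t) = y t := by
    simp only [hc, projIcc_of_mem zero_le_one ⟨hge t ht, hle t ht⟩]
  simpa only [h1] using hy t ht

/-- A solution has a positive denominator before its end time. -/
lemma IsSolution.denom_pos {K T : ℝ} {u : ℝ → ℝ} (hu : IsSolution K T u) {t : ℝ}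
    (ht : t ∈ Ico 0 T) : 0 < denom K (u t) := by
  by_contra! h
  have hc : ContinuousOn (fun s => denom K (u s)) (Icc 0 t) := by
    have := hu.cont.mono (Icc_subset_Icc_right ht.2.le)
    unfold denom
    fun_prop
  -- The denominator starts at $1$ and never vanishes, so it cannot change sign.
  have h0 : denom K (u 0) = 1 := by simp [hu.init, denom]
  obtain ⟨s, hs, hs0⟩ := intermediate_value_Icc' ht.1 hc
    (show (0 : ℝ) ∈ Icc (denom K (u t)) (denom K (u 0)) from ⟨h, by simp [h0]⟩)
  exact hu.denom_ne_zero s ⟨hs.1, hs.2.trans_lt ht.2⟩ hs0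

/-- Two solutions on `[0, T]` agree. -/
lemma IsSolution.eqOn {K T : ℝ} (hK : 0 ≤ K) (hT : 0 < T) {u y : ℝ → ℝ} (hu : IsSolution K T u)
    (hy : IsSolution K T y) : EqOn u y (Icc 0 T) := by
  have key : EqOn u y (Ico 0 T) := by
    intro t ht
    have hsub : Icc 0 t ⊆ Ico 0 T := fun s hs => ⟨hs.1, hs.2.trans_lt ht.2⟩
    -- By compactness, before the end time each solution stays in a region where `rhs` is Lipschitz.
    have hbound : ∀ {w : ℝ → ℝ}, IsSolution K T w → ∃ M δ : ℝ, 0 ≤ M ∧ 0 < δ ∧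
        ∀ s ∈ Icc 0 t, |w s| ≤ M ∧ δ ≤ denom K (w s) := by
      intro w hw
      have hcw := hw.cont.mono (hsub.trans Ico_subset_Icc_self)
      obtain ⟨M, hM⟩ := isCompact_Icc.exists_bound_of_continuousOn hcw
      have hc : ContinuousOn (fun s => denom K (w s)) (Icc 0 t) := by
        unfold denom
        fun_prop
      obtain ⟨s₀, hs₀, hmin⟩ := isCompact_Icc.exists_isMinOn ⟨0, left_mem_Icc.2 ht.1⟩ hc
      exact ⟨M, _, (norm_nonneg _).trans (hM 0 (left_mem_Icc.2 ht.1)), hw.denom_pos (hsub hs₀),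
        fun s hs => ⟨hM s hs, hmin hs⟩⟩
    obtain ⟨M₁, δ₁, hM₁, hδ₁, h₁⟩ := hbound hu
    obtain ⟨M₂, δ₂, -, hδ₂, h₂⟩ := hbound hy
    obtain ⟨L, hL⟩ := rhs_lipschitzOnWith hK (hM₁.trans (le_max_left M₁ M₂)) (lt_min hδ₁ hδ₂)
    have hder : ∀ {w : ℝ → ℝ}, IsSolution K T w → ∀ s ∈ Ico 0 t,
        HasDerivWithinAt w (rhs K (w s)) (Ici s) s := by
      intro w hw s hs
      have hs' := hsub (Ico_subset_Icc_self hs)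
      exact ((hw.deriv s hs').mono (Icc_subset_Icc_left hs.1)).mono_of_mem_nhdsWithin
        (Icc_mem_nhdsGE hs'.2)
    refine ODE_solution_unique_of_mem_Icc_right (v := fun _ => rhs K)
      (s := fun _ => {y | |y| ≤ max M₁ M₂ ∧ min δ₁ δ₂ ≤ denom K y}) (K := L)
      (fun _ _ => hL) (hu.cont.mono (hsub.trans Ico_subset_Icc_self)) (hder hu)
      (fun s hs => ?_) (hy.cont.mono (hsub.trans Ico_subset_Icc_self)) (hder hy)
      (fun s hs => ?_) (by rw [hu.init, hy.init]) ⟨ht.1, le_rfl⟩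
    · have := h₁ s (Ico_subset_Icc_self hs)
      exact ⟨this.1.trans (le_max_left _ _), (min_le_left _ _).trans this.2⟩
    · have := h₂ s (Ico_subset_Icc_self hs)
      exact ⟨this.1.trans (le_max_right _ _), (min_le_right _ _).trans this.2⟩
  -- The equation is not imposed at `T`; the endpoint follows by continuity.
  have hcl : Icc 0 T ⊆ closure (Ico 0 T) := by rw [closure_Ico hT.ne]
  exact key.of_subset_closure hu.cont hy.cont Ico_subset_Icc_self hcl

/-- A global solution with values in the unit interval is the unique solution on `[0, T]`. -/
lemma isUniqueSolution_of_hasDerivWithinAt {K T : ℝ} (hK : 0 < K) (hT : 0 < T) {y : ℝ → ℝ}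
    (h0 : y 0 = 1) (hI : ∀ t, 0 ≤ t → y t ∈ Icc (0 : ℝ) 1)
    (hd : ∀ t, 0 ≤ t → HasDerivWithinAt y (rhs K (y t)) (Ici 0) t) : IsUniqueSolution K T y := by
  have hs : IsSolution K T y :=
    { init := h0
      cont := fun t ht => (hd t ht.1).continuousWithinAt.mono Icc_subset_Ici_self
      denom_ne_zero := fun t ht =>
        ((lt_min one_pos hK).trans_le (min_le_denom (hI t ht.1).1 (hI t ht.1).2)).ne'
      deriv := fun t ht => (hd t ht.1).mono Icc_subset_Ici_self }
  exact ⟨hs, fun u hu => hu.eqOn hK.le hT hs⟩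

lemma isUniqueSolution_zero : IsUniqueSolution 0 1 (fun t => 1 - t) := by
  have hs : IsSolution 0 1 (fun t => 1 - t) :=
    { init := by simp
      cont := by fun_prop
      denom_ne_zero := fun t ht => by
        have : 0 < 1 - t := by linarith [ht.2]
        simp only [mul_zero, add_zero]
        positivity
      deriv := fun t ht => by
        simpa using ((hasDerivAt_id t).const_sub 1).hasDerivWithinAt }
  exact ⟨hs, fun u hu => hu.eqOn le_rfl one_pos hs⟩

/-- Increments of a solution: Lipschitz bound and second-order Taylor bound. -/
lemma abs_solution_sub_le {K : ℝ} {L : ℝ≥0} (hK : 0 < K)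
    (hL : LipschitzOnWith L (rhs K) (Icc 0 1)) {y : ℝ → ℝ}
    (hI : ∀ t, 0 ≤ t → y t ∈ Icc (0 : ℝ) 1)
    (hd : ∀ t, 0 ≤ t → HasDerivWithinAt y (rhs K (y t)) (Ici 0) t) {s t : ℝ} (hs : 0 ≤ s)
    (hst : s ≤ t) : |y t - y s| ≤ L * (t - s) ∧
      |y t - y s - (t - s) * rhs K (y s)| ≤ L * L * (t - s) ^ 2 := by
  have hB : ∀ x ∈ Icc (0 : ℝ) 1, |rhs K x| ≤ L := by
    intro x hx
    have h1 := hL.dist_le_mul _ hx 0 (by simp)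
    rw [rhs_zero hK, Real.dist_eq, Real.dist_eq, sub_zero, sub_zero] at h1
    refine h1.trans (mul_le_of_le_one_right L.2 ?_)
    rw [abs_of_nonneg hx.1]
    exact hx.2
  have h1 : ∀ a, 0 ≤ a → ∀ b, a ≤ b → |y b - y a| ≤ L * (b - a) := by
    intro a ha b hab
    have h := (convex_Ici (0 : ℝ)).norm_image_sub_le_of_norm_hasDerivWithin_le
      (f := y) (f' := fun t => rhs K (y t)) (C := L) (fun x hx => hd x hx)
      (fun x hx => hB _ (hI x hx)) (mem_Ici.2 ha) (mem_Ici.2 (ha.trans hab))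
    rwa [Real.norm_eq_abs, Real.norm_eq_abs, abs_of_nonneg (sub_nonneg.2 hab)] at h
  refine ⟨h1 s hs t hst, ?_⟩
  -- After subtracting the tangent slope at `s`, the remaining derivative is at most `L * (L * (t -
  -- s))`.
  have h := (convex_Icc s t).norm_image_sub_le_of_norm_hasDerivWithin_le
    (f := fun r => y r - r * rhs K (y s)) (f' := fun r => rhs K (y r) - rhs K (y s))
    (C := L * (L * (t - s)))
    (fun x hx => by
      have hx0 : 0 ≤ x := hs.trans hx.1
      have := ((hd x hx0).mono (Icc_subset_Ici_self.trans (Ici_subset_Ici.2 hs))).sub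
        ((hasDerivWithinAt_id x (Icc s t)).mul_const (rhs K (y s)))
      rw [one_mul] at this
      exact this)
    (fun x hx => by
      have hx0 : 0 ≤ x := hs.trans hx.1
      have h2 := hL.dist_le_mul _ (hI x hx0) _ (hI s hs)
      rw [Real.dist_eq, Real.dist_eq] at h2
      refine h2.trans ?_
      have h3 := h1 s hs x hx.1
      have h4 : x - s ≤ t - s := by linarith [hx.2]
      have h5 : |y x - y s| ≤ L * (t - s) := h3.trans (by gcongr)
      gcongr)
    (left_mem_Icc.2 hst) (right_mem_Icc.2 hst)
  rw [Real.norm_eq_abs, Real.norm_eq_abs, abs_of_nonneg (sub_nonneg.2 hst)] at h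
  calc _ = |y t - t * rhs K (y s) - (y s - s * rhs K (y s))| := by congr 1; ring
    _ ≤ _ := h
    _ = _ := by ring

/-! ### Weights and isolated vertices in a single step -/

section Graph

variable {n : ℕ}

/-- The number of isolated vertices of a graph that lie on the pair `e`. -/
def dropCount (G : SimpleGraph (Fin n)) (e : Sym2 (Fin n)) : ℕ :=
  (isolatedSet G ∩ {v | v ∈ e}).ncard

lemma isIsolated_sup_fromEdgeSet {V : Type*} {G : SimpleGraph V} {e : Sym2 V}
    (he : e ∈ missingEdges G) (v : V) :
    (G ⊔ SimpleGraph.fromEdgeSet {e}).IsIsolated v ↔ G.IsIsolated v ∧ v ∉ e := by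
  simp only [SimpleGraph.IsIsolated, SimpleGraph.sup_adj, SimpleGraph.fromEdgeSet_adj,
    mem_singleton_iff, not_or, not_and, forall_and]
  refine and_congr_right fun _ => ⟨?_, ?_⟩
  · rintro h hv
    obtain ⟨w, rfl⟩ := hv
    have h1 : v ≠ w := (SimpleGraph.mem_edgeSet _).1 he |>.ne
    exact h w rfl h1
  · rintro h w rfl
    exact absurd (Sym2.mem_mk_left v w) h

lemma ncard_isolatedSet_sup (G : SimpleGraph (Fin n)) {e : Sym2 (Fin n)}
    (he : e ∈ missingEdges G) :
    (isolatedSet (G ⊔ SimpleGraph.fromEdgeSet {e})).ncard + dropCount G e =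
      (isolatedSet G).ncard := by
  have h1 : isolatedSet (G ⊔ SimpleGraph.fromEdgeSet {e}) = isolatedSet G \ {v | v ∈ e} := by
    ext v
    exact isIsolated_sup_fromEdgeSet he v
  rw [h1, dropCount, add_comm]
  exact Set.ncard_inter_add_ncard_sdiff_eq_ncard _ _ (Set.toFinite _)

lemma dropCount_le_two (G : SimpleGraph (Fin n)) (e : Sym2 (Fin n)) : dropCount G e ≤ 2 := by
  refine (Set.ncard_le_ncard inter_subset_right (Set.toFinite _)).trans ?_
  induction e with
  | _ u v =>
    have : {w | w ∈ s(u, v)} = {u, v} := by ext w; simp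
    rw [this]
    exact (Set.ncard_insert_le _ _).trans (by simp)

lemma ncard_isolatedSet_le (G : SimpleGraph (Fin n)) : (isolatedSet G).ncard ≤ n := by
  simpa using Set.ncard_le_card (isolatedSet G)

/-- The weight of a pair as a real number. -/
def realWeight (K : ℝ≥0) (G : SimpleGraph (Fin n)) (e : Sym2 (Fin n)) : ℝ :=
  (edgeWeight K G e).toReal

open Classical in
lemma realWeight_eq (K : ℝ≥0) (G : SimpleGraph (Fin n)) (e : Sym2 (Fin n)) :
    realWeight K G e = if e ∈ missingEdges G then
      if 2 ≤ (isolatedSet G).ncard ∧ ¬ (∀ v ∈ e, G.IsIsolated v) then (K : ℝ) else 1 else 0 := by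
  rw [realWeight, edgeWeight]
  split_ifs <;> simp

lemma realWeight_nonneg (K : ℝ≥0) (G : SimpleGraph (Fin n)) (e : Sym2 (Fin n)) :
    0 ≤ realWeight K G e := ENNReal.toReal_nonneg

lemma ncard_missingEdges_add (G : SimpleGraph (Fin n)) :
    ((missingEdges G).ncard : ℝ) + G.edgeSet.ncard = n * (n - 1) / 2 := by
  classical
  have h1 : Disjoint Gᶜ.edgeSet G.edgeSet := by
    rw [SimpleGraph.disjoint_edgeSet]
    exact disjoint_compl_left
  have h2 : Gᶜ.edgeSet ∪ G.edgeSet = (⊤ : SimpleGraph (Fin n)).edgeSet := by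
    rw [← SimpleGraph.edgeSet_sup, compl_sup_eq_top]
  have h3 := Set.ncard_union_eq h1 (Set.toFinite _) (Set.toFinite _)
  rw [h2, ← SimpleGraph.coe_edgeFinset, Set.ncard_coe_finset,
    SimpleGraph.card_edgeFinset_top_eq_card_choose_two, Fintype.card_fin] at h3
  rw [missingEdges, ← Nat.cast_add, ← h3, Nat.cast_choose_two]

lemma sum_ite_mem {V : Type*} [Fintype V] [DecidableEq V] (F : Sym2 V → ℝ) (v : V)
    [DecidablePred fun e : Sym2 V => v ∈ e] :
    ∑ e, (if v ∈ e then F e else 0) = ∑ u, F s(v, u) := by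
  rw [← Finset.sum_filter]
  have h : Finset.univ.filter (fun e : Sym2 V => v ∈ e) =
      Finset.univ.image (fun u => s(v, u)) := by
    ext e
    simp only [Finset.mem_filter, Finset.mem_univ, true_and, Finset.mem_image]
    exact ⟨fun ⟨u, hu⟩ => ⟨u, hu.symm⟩, fun ⟨u, hu⟩ => ⟨u, hu.symm⟩⟩
  rw [h, Finset.sum_image]
  intro a _ b _ hab
  exact Sym2.congr_right.1 hab

/-- The total weight, when there are at least two isolated vertices. -/
lemma sum_realWeight (K : ℝ≥0) {G : SimpleGraph (Fin n)} (h2 : 2 ≤ (isolatedSet G).ncard) :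
    ∑ e, realWeight K G e = K * (missingEdges G).ncard +
      (1 - K) * ((isolatedSet G).ncard * ((isolatedSet G).ncard - 1) / 2) := by
  classical
  set S : Finset (Fin n) := Finset.univ.filter G.IsIsolated with hS
  have hSc : (isolatedSet G).ncard = S.card := by
    rw [← Set.ncard_coe_finset]
    congr 1
    ext v
    simp [hS, isolatedSet]
  have hM : (missingEdges G).ncard = (Finset.univ.filter (· ∈ missingEdges G)).card := by
    rw [← Set.ncard_coe_finset]
    congr 1
    ext v
    simp
  -- Two distinct isolated vertices always span a missing edge, so these pairs are counted by a
  -- binomial coefficient.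
  have hI : (Finset.univ.filter fun e => e ∈ missingEdges G ∧ ∀ v ∈ e, G.IsIsolated v) =
      S.offDiag.image Sym2.mk.uncurry := by
    ext e
    induction e with
    | _ u v =>
      rw [Finset.mem_filter]
      simp only [Finset.mem_filter, Finset.mem_univ, true_and, Finset.mem_image,
        Finset.mem_offDiag, hS, Prod.exists, Function.uncurry_apply_pair, missingEdges, SimpleGraph.mem_edgeSet,
        SimpleGraph.compl_adj, Sym2.mem_iff, forall_eq_or_imp, forall_eq]
      constructor
      · rintro ⟨⟨h1, -⟩, h3, h4⟩
        exact ⟨u, v, ⟨h3, h4, h1⟩, rfl⟩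
      · rintro ⟨a, b, ⟨ha, hb, hab⟩, h⟩
        rcases Sym2.eq_iff.1 h with ⟨rfl, rfl⟩ | ⟨rfl, rfl⟩
        · exact ⟨⟨hab, ha b⟩, ha, hb⟩
        · exact ⟨⟨hab.symm, hb a⟩, hb, ha⟩
  have h3 : ∀ e, realWeight K G e = K * (if e ∈ missingEdges G then 1 else 0) +
      (1 - K) * (if e ∈ missingEdges G ∧ ∀ v ∈ e, G.IsIsolated v then 1 else 0) := by
    intro e
    rw [realWeight_eq]
    by_cases he : e ∈ missingEdges G
    · rw [if_pos he, if_pos he]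
      by_cases hi : ∀ v ∈ e, G.IsIsolated v
      · rw [if_neg fun h => h.2 hi, if_pos ⟨he, hi⟩]
        ring
      · rw [if_pos ⟨h2, hi⟩, if_neg fun h => hi h.2]
        ring
    · rw [if_neg he, if_neg he, if_neg fun h => he h.1]
      ring
  simp_rw [h3]
  rw [Finset.sum_add_distrib, ← Finset.mul_sum, ← Finset.mul_sum, Finset.sum_boole,
    Finset.sum_boole, ← hM, hI, Sym2.card_image_offDiag, Nat.cast_choose_two, hSc]

/-- The total weight, when there are fewer than two isolated vertices. -/
lemma sum_realWeight_of_lt (K : ℝ≥0) {G : SimpleGraph (Fin n)}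
    (h2 : (isolatedSet G).ncard < 2) :
    ∑ e, realWeight K G e = (missingEdges G).ncard := by
  classical
  have h3 : ∀ e, realWeight K G e = if e ∈ missingEdges G then 1 else 0 := by
    intro e
    rw [realWeight_eq]
    simp [not_le.2 h2]
  simp_rw [h3]
  rw [Finset.sum_boole, ← Set.ncard_coe_finset]
  congr 2
  ext v
  simp

/-- Double counting: interchanging the sums, each isolated vertex contributes the total weight `a`
of the pairs at it. -/
lemma sum_realWeight_mul_dropCount_aux (K : ℝ≥0) (G : SimpleGraph (Fin n)) {a : ℝ}
    (ha : ∀ v, G.IsIsolated v → ∑ u, realWeight K G s(v, u) = a) :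
    ∑ e, realWeight K G e * dropCount G e = (isolatedSet G).ncard * a := by
  classical
  have h1 : ∀ e, (dropCount G e : ℝ) = ∑ v, if G.IsIsolated v ∧ v ∈ e then 1 else 0 := by
    intro e
    rw [Finset.sum_boole, dropCount, ← Set.ncard_coe_finset]
    congr 2
    ext v
    simp [isolatedSet]
  have h2 : ∀ v, ∑ e, realWeight K G e * (if G.IsIsolated v ∧ v ∈ e then 1 else 0) =
      if G.IsIsolated v then a else 0 := by
    intro v
    by_cases hv : G.IsIsolated v
    · simp only [hv, true_and, mul_ite, mul_one, mul_zero, if_true]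
      rw [sum_ite_mem, ha v hv]
    · simp [hv]
  simp_rw [h1, Finset.mul_sum]
  rw [Finset.sum_comm]
  simp_rw [h2]
  rw [← Finset.sum_filter, Finset.sum_const, nsmul_eq_mul, ← Set.ncard_coe_finset]
  congr 3
  ext v
  simp [isolatedSet]

lemma mem_missingEdges_of_isIsolated {G : SimpleGraph (Fin n)} {v : Fin n} (hv : G.IsIsolated v)
    (u : Fin n) : s(v, u) ∈ missingEdges G ↔ u ≠ v := by
  simp only [missingEdges, SimpleGraph.mem_edgeSet, SimpleGraph.compl_adj, ne_comm (a := u)]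
  exact ⟨fun h => h.1, fun h => ⟨h, hv u⟩⟩

/-- The weighted number of vertices that stop being isolated, when there are at least two isolated
vertices. -/
lemma sum_realWeight_mul_dropCount (K : ℝ≥0) {G : SimpleGraph (Fin n)}
    (h2 : 2 ≤ (isolatedSet G).ncard) :
    ∑ e, realWeight K G e * dropCount G e = (isolatedSet G).ncard *
      ((isolatedSet G).ncard - 1 + K * (n - (isolatedSet G).ncard)) := by
  classical
  refine sum_realWeight_mul_dropCount_aux K G fun v hv => ?_
  -- The last term cancels the loop `u = v`, since `v` itself is isolated.
  have h3 : ∀ u, realWeight K G s(v, u) =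
      (1 - K) * (if G.IsIsolated u then 1 else 0) + K - (if u = v then 1 else 0) := by
    intro u
    rw [realWeight_eq]
    simp only [mem_missingEdges_of_isIsolated hv, h2, true_and, Sym2.mem_iff, forall_eq_or_imp,
      forall_eq, hv]
    by_cases huv : u = v
    · simp [huv, hv]
    · by_cases hu : G.IsIsolated u <;> simp [huv, hu]
  simp_rw [h3]
  rw [Finset.sum_sub_distrib, Finset.sum_add_distrib, ← Finset.mul_sum, Finset.sum_boole]
  have h4 : (Finset.univ.filter G.IsIsolated).card = (isolatedSet G).ncard := by
    rw [← Set.ncard_coe_finset]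
    congr 1
    ext v
    simp [isolatedSet]
  rw [h4]
  simp
  ring

/-- The weighted number of vertices that stop being isolated, when there are fewer than two
isolated vertices. -/
lemma sum_realWeight_mul_dropCount_of_lt (K : ℝ≥0) {G : SimpleGraph (Fin n)}
    (h2 : (isolatedSet G).ncard < 2) :
    ∑ e, realWeight K G e * dropCount G e = (isolatedSet G).ncard * (n - 1) := by
  classical
  refine sum_realWeight_mul_dropCount_aux K G fun v hv => ?_
  have h3 : ∀ u, realWeight K G s(v, u) = 1 - (if u = v then 1 else 0) := by
    intro u
    rw [realWeight_eq]
    simp only [mem_missingEdges_of_isIsolated hv, not_le.2 h2, false_and]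
    by_cases huv : u = v <;> simp [huv]
  simp_rw [h3]
  rw [Finset.sum_sub_distrib]
  simp

/-- The graphs that can follow `G`. -/
lemma exists_of_stepLaw_ne_zero {K : ℝ≥0} {G H : SimpleGraph (Fin n)}
    (h : stepLaw K G H ≠ 0) :
    (G = ⊤ ∧ H = ⊤) ∨ ∃ e, edgeWeight K G e ≠ 0 ∧ H = G ⊔ SimpleGraph.fromEdgeSet {e} := by
  rw [stepLaw] at h
  split_ifs at h with hG
  · left
    refine ⟨hG, ?_⟩
    by_contra hH
    exact h (by rw [PMF.pure_apply, if_neg hH])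
  · right
    rw [← PMF.mem_support_iff, PMF.support_map, PMF.support_normalize] at h
    obtain ⟨e, he, rfl⟩ := h
    exact ⟨e, he, rfl⟩

lemma mem_missingEdges_of_edgeWeight_ne_zero {K : ℝ≥0} {G : SimpleGraph (Fin n)}
    {e : Sym2 (Fin n)} (h : edgeWeight K G e ≠ 0) : e ∈ missingEdges G := by
  by_contra he
  exact h (by rw [edgeWeight, if_neg he])

/-- In one step the number of isolated vertices drops by at most two, and the number of edges grows
by at most one. -/
lemma stepLaw_bounds {K : ℝ≥0} {G H : SimpleGraph (Fin n)} (h : stepLaw K G H ≠ 0) :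
    (isolatedSet H).ncard ≤ (isolatedSet G).ncard ∧
      (isolatedSet G).ncard ≤ (isolatedSet H).ncard + 2 ∧
      H.edgeSet.ncard ≤ G.edgeSet.ncard + 1 := by
  rcases exists_of_stepLaw_ne_zero h with ⟨rfl, rfl⟩ | ⟨e, he, rfl⟩
  · omega
  · have h1 := ncard_isolatedSet_sup G (mem_missingEdges_of_edgeWeight_ne_zero he)
    have h2 := dropCount_le_two G e
    refine ⟨by omega, by omega, ?_⟩
    rw [SimpleGraph.edgeSet_sup, SimpleGraph.edgeSet_fromEdgeSet]
    refine (Set.ncard_union_le _ _).trans ?_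
    gcongr
    refine (Set.ncard_le_ncard sdiff_subset (Set.toFinite _)).trans ?_
    simp

/-- With `K = 0` each step joins two isolated vertices, as long as there are two. -/
lemma stepLaw_zero {G H : SimpleGraph (Fin n)} (h : stepLaw 0 G H ≠ 0)
    (h2 : 2 ≤ (isolatedSet G).ncard) :
    (isolatedSet H).ncard + 2 = (isolatedSet G).ncard := by
  rcases exists_of_stepLaw_ne_zero h with ⟨rfl, rfl⟩ | ⟨e, he, rfl⟩
  · obtain ⟨u, v, hu, hv, huv⟩ := (Set.one_lt_ncard_iff (Set.toFinite _)).1 h2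
    exact absurd huv (hu v)
  · have hm := mem_missingEdges_of_edgeWeight_ne_zero he
    have h1 := ncard_isolatedSet_sup G hm
    have hi : ∀ v ∈ e, G.IsIsolated v := by
      by_contra hc
      exact he (by rw [edgeWeight, if_pos hm, if_pos ⟨h2, hc⟩, ENNReal.coe_zero])
    have h3 : dropCount G e = 2 := by
      induction e with
      | _ u v =>
        have : isolatedSet G ∩ {w | w ∈ s(u, v)} = {u, v} := by
          ext w
          simp only [mem_inter_iff, Set.mem_ofPred_eq, Sym2.mem_iff, mem_insert_iff,
            mem_singleton_iff]
          exact ⟨fun h => h.2, fun h => ⟨hi w (Sym2.mem_iff.2 h), h⟩⟩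
        rw [dropCount, this]
        exact Set.ncard_pair ((SimpleGraph.mem_edgeSet _).1 hm).ne
    omega

/-- Expectations of functions of the number of isolated vertices after one step. -/
lemma integral_stepLaw (K : ℝ≥0) {G : SimpleGraph (Fin n)} (hG : G ≠ ⊤) (φ : ℝ → ℝ) :
    ∫ H, φ (isolatedSet H).ncard ∂(stepLaw K G).toMeasure =
      (∑ e, realWeight K G e * φ ((isolatedSet G).ncard - dropCount G e)) /
        ∑ e, realWeight K G e := by
  classical
  have hW : (∑' e, edgeWeight K G e).toReal = ∑ e, realWeight K G e := by
    rw [tsum_fintype, ENNReal.toReal_sum]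
    · rfl
    · intro e _
      unfold edgeWeight
      split_ifs <;> simp
  rw [stepLaw, dif_neg hG, PMF.integral_eq_sum, Finset.sum_div]
  simp only [PMF.map_apply, tsum_fintype]
  have h1 : ∀ H : SimpleGraph (Fin n), (∑ e, if H = G ⊔ SimpleGraph.fromEdgeSet {e} then
      (PMF.normalize (edgeWeight K G) (tsum_edgeWeight_ne_zero K hG)
        (tsum_edgeWeight_ne_top K G)) e else 0).toReal =
      ∑ e, if H = G ⊔ SimpleGraph.fromEdgeSet {e} then
        realWeight K G e / ∑ e, realWeight K G e else 0 := by
    intro H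
    rw [ENNReal.toReal_sum]
    · refine Finset.sum_congr rfl fun e _ => ?_
      split_ifs
      · rw [PMF.normalize_apply, ENNReal.toReal_mul, ENNReal.toReal_inv, hW, div_eq_mul_inv]
        rfl
      · simp
    · intro e _
      split_ifs
      · exact PMF.apply_ne_top _ _
      · simp
  simp_rw [h1, smul_eq_mul, Finset.sum_mul]
  rw [Finset.sum_comm]
  refine Finset.sum_congr rfl fun e _ => ?_
  simp only [ite_mul, zero_mul, Finset.sum_ite_eq', Finset.mem_univ, if_true]
  by_cases he : e ∈ missingEdges G
  · have h2 := ncard_isolatedSet_sup G he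
    have h3 : ((isolatedSet G).ncard : ℝ) - dropCount G e =
        (isolatedSet (G ⊔ SimpleGraph.fromEdgeSet {e})).ncard := by
      rw [← h2]
      push_cast
      ring
    rw [h3]
    ring
  -- Off the missing edges the formula for the new count may fail, but the weight is zero.
  · have : realWeight K G e = 0 := by rw [realWeight_eq, if_neg he]
    simp [this]

end Graph

/-! ### The law of the whole process -/

section Trajectory

variable {n : ℕ} {K : ℝ≥0}

instance instIsProbabilityMeasureProcessLaw : IsProbabilityMeasure (processLaw n K) := by
  unfold processLaw
  infer_instance

/-- The Markov property, the source of all almost sure and averaged one-step statements below. -/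
lemma processLaw_compProd (m : ℕ) :
    (processLaw n K).map (Preorder.frestrictLe m) ⊗ₘ stepKernel K m =
      (processLaw n K).map (fun ω => (Preorder.frestrictLe m ω, ω (m + 1))) :=
  Kernel.map_frestrictLe_trajMeasure_compProd_eq_map_trajMeasure

lemma ae_init : ∀ᵐ ω ∂processLaw n K, ω 0 = ⊥ := by
  have h1 : (processLaw n K).map (Preorder.frestrictLe 0) =
      (Measure.dirac ⊥).map
        (MeasurableEquiv.piUnique (fun _ : Finset.Iic 0 => SimpleGraph (Fin n))).symm := by
    rw [processLaw, Kernel.trajMeasure, Measure.map_comp _ _ (by fun_prop),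
      Kernel.traj_map_frestrictLe, Kernel.partialTraj_self, Measure.id_comp]
  have h2 : ∀ᵐ h ∂(processLaw n K).map (Preorder.frestrictLe 0),
      h ⟨0, Finset.mem_Iic.2 le_rfl⟩ = ⊥ := by
    rw [h1, ae_map_iff (by fun_prop) (.of_discrete), ae_dirac_iff (.of_discrete)]
    rfl
  exact ae_of_ae_map (by fun_prop) h2

lemma ae_stepLaw_ne_zero : ∀ᵐ ω ∂processLaw n K, ∀ m, stepLaw K (ω m) (ω (m + 1)) ≠ 0 := by
  rw [ae_all_iff]
  intro m
  have h1 : ∀ᵐ p ∂(processLaw n K).map (fun ω => (Preorder.frestrictLe m ω, ω (m + 1))),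
      stepLaw K (p.1 ⟨m, Finset.mem_Iic.2 le_rfl⟩) p.2 ≠ 0 := by
    rw [← processLaw_compProd, Measure.ae_compProd_iff (.of_discrete)]
    refine ae_of_all _ fun h => ?_
    change ∀ᵐ H ∂(stepLaw K (h ⟨m, Finset.mem_Iic.2 le_rfl⟩)).toMeasure, _
    rw [ae_iff, PMF.toMeasure_apply_eq_zero_iff _ (.of_discrete), Set.disjoint_left]
    intro H hH hH'
    exact hH' ((PMF.mem_support_iff _ _).1 hH)
  exact ae_of_ae_map (f := fun ω => (Preorder.frestrictLe m ω, ω (m + 1))) (by fun_prop) h1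

lemma integral_succ (m : ℕ) (φ : SimpleGraph (Fin n) → ℝ) :
    ∫ ω, φ (ω (m + 1)) ∂processLaw n K =
      ∫ ω, ∫ H, φ H ∂(stepLaw K (ω m)).toMeasure ∂processLaw n K := by
  have h1 : ∫ ω, φ (ω (m + 1)) ∂processLaw n K =
      ∫ p, φ p.2 ∂(processLaw n K).map (fun ω => (Preorder.frestrictLe m ω, ω (m + 1))) := by
    rw [integral_map (by fun_prop) (Measurable.of_discrete).aestronglyMeasurable]
  rw [h1, ← processLaw_compProd, Measure.integral_compProd .of_finite,
    integral_map (by fun_prop) (Measurable.of_discrete).aestronglyMeasurable]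
  rfl

/-- Almost surely, the graph after `m` steps has at most `m` edges. -/
lemma ae_ncard_edgeSet_le : ∀ᵐ ω ∂processLaw n K, ∀ m, (ω m).edgeSet.ncard ≤ m := by
  filter_upwards [ae_init, ae_stepLaw_ne_zero] with ω h0 hs m
  induction m with
  | zero => simp [h0]
  | succ m ih => exact (stepLaw_bounds (hs m)).2.2.trans (by omega)

/-- Almost surely, the number of isolated vertices decreases, by at most two per step. -/
lemma ae_ncard_isolatedSet : ∀ᵐ ω ∂processLaw n K, ∀ m k,
    (isolatedSet (ω (m + k))).ncard ≤ (isolatedSet (ω m)).ncard ∧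
      (isolatedSet (ω m)).ncard ≤ (isolatedSet (ω (m + k))).ncard + 2 * k := by
  filter_upwards [ae_stepLaw_ne_zero] with ω hs m k
  induction k with
  | zero => simp
  | succ k ih =>
    have := stepLaw_bounds (hs (m + k))
    rw [add_assoc] at this
    omega

lemma ncard_isolatedSet_bot : (isolatedSet (⊥ : SimpleGraph (Fin n))).ncard = n := by
  have : isolatedSet (⊥ : SimpleGraph (Fin n)) = univ := by
    ext v
    simp [isolatedSet]
  rw [this, Set.ncard_univ, Nat.card_fin]

/-- For `K = 0` the number of isolated vertices is deterministic during the first `n / 2` steps. -/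
lemma ae_ncard_isolatedSet_zero : ∀ᵐ ω ∂processLaw n 0, ∀ m, 2 * m ≤ n →
    (isolatedSet (ω m)).ncard + 2 * m = n := by
  filter_upwards [ae_init, ae_stepLaw_ne_zero] with ω h0 hs m
  induction m with
  | zero => simp [h0, ncard_isolatedSet_bot]
  | succ m ih =>
    intro hm
    have h1 := ih (by omega)
    have h2 := stepLaw_zero (hs m) (by omega)
    omega

end Trajectory

/-! ### The expected one-step drop -/

/-- Comparison of a ratio with the ratio of its leading terms. -/
lemma abs_ratio_sub_le {n S W N D δ q c : ℝ} (hn : 0 < n) (hδ : 0 < δ) (hc : 0 ≤ c)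
    (hN0 : 0 ≤ N) (hNq : N ≤ q) (hD : δ ≤ D) (hDq : D ≤ q) (hS : |S - n ^ 2 * N| ≤ n)
    (hW : |W - n ^ 2 * D / 2| ≤ c * n) (hnc : 4 * c ≤ δ * n) :
    0 < W ∧ |S / W - 2 * (N / D)| ≤ 4 * q * (1 + 2 * c) / δ ^ 2 / n := by
  have hD0 : 0 < D := hδ.trans_le hD
  have hq0 : 0 ≤ q := hN0.trans hNq
  -- `hnc` makes the error `c * n` at most half of the lower bound $n^2\delta/2$ of the main term.
  have hW1 : n ^ 2 * δ / 4 ≤ W := by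
    have h1 := (abs_le.1 hW).1
    nlinarith [mul_le_mul_of_nonneg_left hD (sq_nonneg n), mul_le_mul_of_nonneg_left hnc hn.le]
  have hW0 : 0 < W := lt_of_lt_of_le (by positivity) hW1
  refine ⟨hW0, ?_⟩
  have e1 : S / W - 2 * (N / D) =
      ((S - n ^ 2 * N) * D - 2 * N * (W - n ^ 2 * D / 2)) / (W * D) := by
    field_simp
    ring
  have h2 : |(S - n ^ 2 * N) * D - 2 * N * (W - n ^ 2 * D / 2)| ≤ q * (1 + 2 * c) * n := by
    calc _ ≤ |(S - n ^ 2 * N) * D| + |2 * N * (W - n ^ 2 * D / 2)| := abs_sub _ _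
      _ = |S - n ^ 2 * N| * D + 2 * N * |W - n ^ 2 * D / 2| := by
        rw [abs_mul, abs_mul, abs_of_pos hD0, abs_of_nonneg (by positivity : 0 ≤ 2 * N)]
      _ ≤ n * q + 2 * q * (c * n) := by gcongr
      _ = _ := by ring
  rw [e1, abs_div, abs_of_pos (mul_pos hW0 hD0)]
  have hq : 0 ≤ q * (1 + 2 * c) * n := (abs_nonneg _).trans h2
  calc _ ≤ q * (1 + 2 * c) * n / (n ^ 2 * δ / 4 * δ) := by gcongr
    _ = _ := by field_simp

/-- The factor `x` in the upper bound makes `rhs` of order $1/n$ when at most one vertex is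
isolated. -/
lemma numerator_bounds {K x : ℝ} (hK : 0 ≤ K) (hx0 : 0 ≤ x) (hx1 : x ≤ 1) :
    0 ≤ x ^ 2 + K * x * (1 - x) ∧ x ^ 2 + K * x * (1 - x) ≤ (1 + K) * x := by
  have h1 : 0 ≤ K * x * (1 - x) := mul_nonneg (by positivity) (by linarith)
  refine ⟨by positivity, ?_⟩
  have h2 : 0 ≤ x * (1 - x) := mul_nonneg hx0 (by linarith)
  have h3 : 0 ≤ K * (x * x) := by positivity
  linarith [show (1 + K) * x - (x ^ 2 + K * x * (1 - x)) = x * (1 - x) + K * (x * x) by ring]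

lemma denom_le {K x : ℝ} (hK : 0 ≤ K) (hx0 : 0 ≤ x) (hx1 : x ≤ 1) : denom K x ≤ 1 + K := by
  have h2 : x ^ 2 ≤ 1 := pow_le_one₀ hx0 hx1
  have h3 : 0 ≤ x ^ 2 * K := by positivity
  rw [denom]
  linarith

/-- With $x=X/n$, the leading terms are $n^2(x^2+Kx(1-x))$ for `S` and $n^2/2$ times the denominator
for `W`; the existing edges `E` and all other terms are $O(n)$. -/
lemma abs_ratio_add_rhs_le {K C n X E S W : ℝ} (hK : 0 < K) (hn : 0 < n) (hX0 : 0 ≤ X)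
    (hXn : X ≤ n) (hE0 : 0 ≤ E) (hE : E ≤ C * n) (hC : 0 ≤ C)
    (hS : S = X * (X - 1 + K * (n - X)))
    (hW : W = K * (n * (n - 1) / 2 - E) + (1 - K) * (X * (X - 1) / 2))
    (hnc : 4 * (K + K * C + 1) ≤ min 1 K * n) :
    0 < W ∧ |S / W + 2 * rhs K (X / n)| ≤
      4 * (1 + K) * (1 + 2 * (K + K * C + 1)) / min 1 K ^ 2 / n := by
  have hx0 : 0 ≤ X / n := by positivity
  have hx1 : X / n ≤ 1 := by rwa [div_le_one hn]
  have hδ : 0 < min 1 K := lt_min one_pos hK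
  obtain ⟨hN0, hN1⟩ := numerator_bounds hK.le hx0 hx1
  have hD := min_le_denom (K := K) hx0 hx1
  have hr : S / W + 2 * rhs K (X / n) = S / W -
      2 * (((X / n) ^ 2 + K * (X / n) * (1 - X / n)) / denom K (X / n)) := by
    rw [rhs_eq (hδ.trans_le hD).ne', neg_div]
    ring
  rw [hr]
  refine abs_ratio_sub_le hn hδ (by positivity) hN0
    (hN1.trans (mul_le_of_le_one_right (by positivity) hx1)) hD (denom_le hK.le hx0 hx1) ?_ ?_ hnc
  · have : S - n ^ 2 * ((X / n) ^ 2 + K * (X / n) * (1 - X / n)) = -X := by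
      rw [hS]
      field_simp
      ring
    rw [this, abs_neg, abs_of_nonneg hX0]
    exact hXn
  · have h3 : W - n ^ 2 * denom K (X / n) / 2 =
        K * X / 2 - K * n / 2 - K * E - X / 2 := by
      rw [hW, denom]
      field_simp
      ring
    have h4 : K * E ≤ K * (C * n) := by gcongr
    have h5 : 0 ≤ K * E := by positivity
    have h6 : K * X ≤ K * n := by gcongr
    have h7 : 0 ≤ K * X := by positivity
    have h9 : 0 ≤ K * (C * n) := by positivity
    have h10 : (K + K * C + 1) * n = K * n + K * (C * n) + n := by ring
    rw [h3, h10, abs_le]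
    constructor <;> linarith

/-- Under the modified weights no cancellation is needed: both terms are separately $O(1/n)$. -/
lemma abs_ratio_add_rhs_le_of_le_one {K C n X E : ℝ} (hK : 0 < K) (hX0 : 0 ≤ X)
    (hX1 : X ≤ 1) (hE : E ≤ C * n) (hC : 0 ≤ C) (hnC : 2 + 4 * C ≤ n) :
    0 < n * (n - 1) / 2 - E ∧ |X * (n - 1) / (n * (n - 1) / 2 - E) + 2 * rhs K (X / n)| ≤
      (4 + 2 * (1 + K) / min 1 K) / n := by
  have hn : 0 < n := by linarith
  have hx0 : 0 ≤ X / n := by positivity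
  have hx1 : X / n ≤ 1 := by rw [div_le_one hn]; linarith
  have hδ : 0 < min 1 K := lt_min one_pos hK
  obtain ⟨hN0, hN1⟩ := numerator_bounds hK.le hx0 hx1
  have hD := min_le_denom (K := K) hx0 hx1
  have hD0 := hδ.trans_le hD
  have hMn : n ^ 2 / 4 ≤ n * (n - 1) / 2 - E := by nlinarith
  have hM0 : 0 < n * (n - 1) / 2 - E := lt_of_lt_of_le (by positivity) hMn
  refine ⟨hM0, ?_⟩
  have hn1 : 0 ≤ n - 1 := by linarith
  have h3 : X * (n - 1) / (n * (n - 1) / 2 - E) ≤ 4 / n := by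
    calc _ ≤ 1 * n / (n ^ 2 / 4) := by gcongr; linarith
      _ = 4 / n := by field_simp
  have h4 : 0 ≤ X * (n - 1) / (n * (n - 1) / 2 - E) := by positivity
  have h5 : -rhs K (X / n) ≤ (1 + K) / min 1 K / n := by
    rw [rhs_eq hD0.ne', neg_div, neg_neg]
    calc _ ≤ (1 + K) * (1 / n) / min 1 K := by
          gcongr
          exact hN1.trans (by gcongr)
      _ = _ := by field_simp
  have h6 : rhs K (X / n) ≤ 0 := rhs_nonpos hK hx0 hx1
  have h7 : (4 + 2 * (1 + K) / min 1 K) / n = 4 / n + 2 * ((1 + K) / min 1 K / n) := by ring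
  have h8 : 0 ≤ 4 / n := by positivity
  have h9 : 0 ≤ (1 + K) / min 1 K / n := by positivity
  rw [h7, abs_le]
  constructor <;> linarith

/-- The expected drop of the number of isolated vertices in one step is close to its limit. -/
lemma exists_drift_bound {K : ℝ≥0} (hK : 0 < K) {C : ℝ} (hC : 0 ≤ C) :
    ∃ c : ℝ, 0 ≤ c ∧ ∃ n₀ : ℕ, ∀ n : ℕ, n₀ ≤ n → 0 < n ∧ ∀ G : SimpleGraph (Fin n),
      (G.edgeSet.ncard : ℝ) ≤ C * n → 0 < ∑ e, realWeight K G e ∧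
        |(∑ e, realWeight K G e * dropCount G e) / (∑ e, realWeight K G e) +
          2 * rhs K (isolatedFraction G)| ≤ c / n := by
  have hK' : (0 : ℝ) < K := hK
  have hδ : 0 < min 1 (K : ℝ) := lt_min one_pos hK'
  have hc : 0 ≤ 4 * (K + K * C + 1) / min 1 (K : ℝ) := by positivity
  obtain ⟨n₀, hn₀⟩ := exists_nat_ge (4 * (K + K * C + 1) / min 1 (K : ℝ) + (2 + 4 * C))
  refine ⟨max (4 * (1 + K) * (1 + 2 * (K + K * C + 1)) / min 1 (K : ℝ) ^ 2)
    (4 + 2 * (1 + K) / min 1 (K : ℝ)), le_max_of_le_right (by positivity), n₀, fun n hn => ?_⟩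
  have hn1 : 4 * (K + K * C + 1) / min 1 (K : ℝ) + (2 + 4 * C) ≤ n := hn₀.trans (Nat.cast_le.2 hn)
  have hn2 : 2 + 4 * C ≤ n := by linarith
  have hn3 : 4 * (K + K * C + 1) ≤ min 1 (K : ℝ) * n := by
    rw [← div_le_iff₀' hδ]
    linarith
  have hnpos : (0 : ℝ) < n := by linarith
  refine ⟨Nat.cast_pos.1 hnpos, fun G hG => ?_⟩
  have hM : ((missingEdges G).ncard : ℝ) = n * (n - 1) / 2 - G.edgeSet.ncard :=
    eq_sub_of_add_eq (ncard_missingEdges_add G)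
  by_cases h2 : 2 ≤ (isolatedSet G).ncard
  · have hW := sum_realWeight K h2
    rw [hM] at hW
    obtain ⟨h3, h4⟩ := abs_ratio_add_rhs_le hK' hnpos (Nat.cast_nonneg _)
      (Nat.cast_le.2 (ncard_isolatedSet_le G)) (Nat.cast_nonneg _) hG hC
      (sum_realWeight_mul_dropCount K h2) hW hn3
    exact ⟨h3, h4.trans (div_le_div_of_nonneg_right (le_max_left _ _) hnpos.le)⟩
  · rw [not_le] at h2
    rw [sum_realWeight_mul_dropCount_of_lt K h2, sum_realWeight_of_lt K h2, hM]
    obtain ⟨h3, h4⟩ := abs_ratio_add_rhs_le_of_le_one hK' (Nat.cast_nonneg (isolatedSet G).ncard)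
      (Nat.cast_le_one.2 (Nat.lt_succ_iff.1 h2)) hG hC hn2
    exact ⟨h3, h4.trans (div_le_div_of_nonneg_right (le_max_right _ _) hnpos.le)⟩

/-! ### Mean square deviation -/

/-- Second moment of the deviation after one random decrement, for weights `w`. -/
lemma weighted_sq_le {ι : Type*} (s : Finset ι) {w d : ι → ℝ} (hw : ∀ i ∈ s, 0 ≤ w i)
    (hW : 0 < ∑ i ∈ s, w i) {e Δ n L B c : ℝ} (hn : 0 < n) (he : |e| ≤ 1)
    (hd : ∀ i ∈ s, |d i / n + Δ| ≤ B / n)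
    (hdrift : |(∑ i ∈ s, w i * d i) / (∑ i ∈ s, w i) / n + Δ| ≤ L / n * |e| + c / n ^ 2)
    (hc : 0 ≤ c) :
    (∑ i ∈ s, w i * (e - (d i / n + Δ)) ^ 2) / ∑ i ∈ s, w i ≤
      (1 + 2 * L / n) * e ^ 2 + (2 * c + B ^ 2) / n ^ 2 := by
  set W := ∑ i ∈ s, w i with hWdef
  set μ := (∑ i ∈ s, w i * d i) / W / n + Δ with hμ
  have h1 : ∑ i ∈ s, w i * (e - (d i / n + Δ)) ^ 2 =
      W * e ^ 2 - 2 * e * (W * μ) + ∑ i ∈ s, w i * (d i / n + Δ) ^ 2 := by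
    have h2 : W * μ = ∑ i ∈ s, w i * (d i / n + Δ) := by
      simp_rw [mul_add, Finset.sum_add_distrib, ← Finset.sum_mul, ← mul_div_assoc,
        ← Finset.sum_div]
      rw [hμ, ← hWdef]
      field_simp
    rw [h2, hWdef, Finset.sum_mul, Finset.mul_sum, ← Finset.sum_sub_distrib,
      ← Finset.sum_add_distrib]
    exact Finset.sum_congr rfl fun i _ => by ring
  have h3 : ∑ i ∈ s, w i * (d i / n + Δ) ^ 2 ≤ W * (B / n) ^ 2 := by
    rw [hWdef, Finset.sum_mul]
    refine Finset.sum_le_sum fun i hi => mul_le_mul_of_nonneg_left ?_ (hw i hi)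
    exact sq_le_sq.2 ((hd i hi).trans (le_abs_self _))
  -- Only the cross term sees the drift; `|e| ≤ 1` turns its part linear in `e` into a constant.
  have h4 : -(2 * e * μ) ≤ 2 * L / n * e ^ 2 + 2 * c / n ^ 2 := by
    calc -(2 * e * μ) ≤ |2 * e * μ| := neg_le_abs _
      _ = 2 * |e| * |μ| := by rw [abs_mul, abs_mul, abs_two]
      _ ≤ 2 * |e| * (L / n * |e| + c / n ^ 2) := by gcongr
      _ = 2 * L / n * |e| ^ 2 + 2 * c / n ^ 2 * |e| := by ring
      _ ≤ 2 * L / n * e ^ 2 + 2 * c / n ^ 2 := by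
        rw [sq_abs]
        gcongr
        exact mul_le_of_le_one_right (by positivity) he
  rw [div_le_iff₀ hW, h1]
  calc _ ≤ W * (e ^ 2 + -(2 * e * μ) + (B / n) ^ 2) := by linarith
    _ ≤ W * (e ^ 2 + (2 * L / n * e ^ 2 + 2 * c / n ^ 2) + (B / n) ^ 2) := by gcongr
    _ = _ := by ring

lemma isolatedFraction_mem {n : ℕ} (G : SimpleGraph (Fin n)) :
    isolatedFraction G ∈ Icc (0 : ℝ) 1 := by
  refine ⟨by unfold isolatedFraction; positivity, div_le_one_of_le₀ ?_ (Nat.cast_nonneg _)⟩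
  exact_mod_cast ncard_isolatedSet_le G

/-- One-step estimate for the mean square deviation from the solution. -/
lemma exists_one_step_bound {K : ℝ≥0} (hK : 0 < K) {C : ℝ} (hC : 0 ≤ C) {y : ℝ → ℝ}
    (hI : ∀ t, 0 ≤ t → y t ∈ Icc (0 : ℝ) 1)
    (hd : ∀ t, 0 ≤ t → HasDerivWithinAt y (rhs K (y t)) (Ici 0) t) :
    ∃ a b : ℝ, 0 ≤ a ∧ 0 ≤ b ∧ ∃ n₀ : ℕ, ∀ n : ℕ, n₀ ≤ n → 0 < n ∧
      ∀ G : SimpleGraph (Fin n), ∀ m : ℕ,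
      (G.edgeSet.ncard : ℝ) ≤ C * n →
        ∫ H, (isolatedFraction H - y (2 * (m + 1 : ℕ) / n)) ^ 2 ∂(stepLaw K G).toMeasure ≤
          (1 + a / n) * (isolatedFraction G - y (2 * m / n)) ^ 2 + b / n ^ 2 := by
  have hK' : (0 : ℝ) < K := hK
  obtain ⟨L, hL⟩ := exists_lipschitz_rhs hK'
  obtain ⟨c, hc, n₀, h⟩ := exists_drift_bound hK hC
  -- `2 * L` is the Lipschitz constant over a time step `2 / n`, `L * L * 4` the Taylor error, and
  -- `2 + 2 * L` bounds the drop plus the move of `y`, times $n$.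
  refine ⟨2 * (2 * L), 2 * (c + L * L * 4) + (2 + 2 * L) ^ 2, by positivity, by positivity, n₀,
    fun n hn => ⟨(h n hn).1, fun G m hG => ?_⟩⟩
  obtain ⟨hn0, h'⟩ := h n hn
  obtain ⟨hW, hdrift⟩ := h' G hG
  have hn0' : (0 : ℝ) < n := by exact_mod_cast hn0
  have hGtop : G ≠ ⊤ := by
    rintro rfl
    have : ∑ e, realWeight K (⊤ : SimpleGraph (Fin n)) e = 0 := by
      refine Finset.sum_eq_zero fun e _ => ?_
      rw [realWeight_eq, if_neg]
      simp [missingEdges]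
    exact hW.ne' this
  set t : ℝ := 2 * m / n with ht
  have ht0 : 0 ≤ t := by positivity
  have ht' : 2 * ((m + 1 : ℕ) : ℝ) / n = t + 2 / n := by
    rw [ht]
    push_cast
    ring
  rw [ht']
  set Δ : ℝ := y (t + 2 / n) - y t with hΔ
  obtain ⟨hy1, hy2⟩ := abs_solution_sub_le hK' hL hI hd ht0
    (show t ≤ t + 2 / n by linarith [show 0 ≤ 2 / (n : ℝ) by positivity])
  rw [add_sub_cancel_left, ← hΔ] at hy1 hy2
  set e : ℝ := isolatedFraction G - y t with he
  have hx := isolatedFraction_mem G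
  have hyt := hI t ht0
  have h1 := integral_stepLaw K hGtop (fun X => (X / n - y (t + 2 / n)) ^ 2)
  have h2 : ∀ f : Sym2 (Fin n), realWeight K G f *
      ((((isolatedSet G).ncard : ℝ) - dropCount G f) / n - y (t + 2 / n)) ^ 2 =
      realWeight K G f * (e - (dropCount G f / n + Δ)) ^ 2 := by
    intro f
    rw [he, hΔ, isolatedFraction]
    ring
  simp_rw [h2] at h1
  change ∫ H : SimpleGraph (Fin n), (((isolatedSet H).ncard : ℝ) / n - y (t + 2 / n)) ^ 2
    ∂(stepLaw K G).toMeasure ≤ _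
  rw [h1]
  refine weighted_sq_le Finset.univ (fun f _ => realWeight_nonneg K G f) hW hn0'
    (abs_le.2 ⟨by linarith [hx.1, hyt.2], by linarith [hx.2, hyt.1]⟩) (fun f _ => ?_) ?_
    (by positivity)
  · have h3 : (dropCount G f : ℝ) ≤ 2 := by exact_mod_cast dropCount_le_two G f
    calc |(dropCount G f : ℝ) / n + Δ| ≤ |(dropCount G f : ℝ) / n| + |Δ| := abs_add_le _ _
      _ ≤ 2 / n + L * (2 / n) := by
        rw [abs_of_nonneg (by positivity : (0 : ℝ) ≤ dropCount G f / n)]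
        gcongr
      _ = _ := by ring
  · set r := (∑ f, realWeight K G f * dropCount G f) / ∑ f, realWeight K G f with hr
    have h4 := hL.dist_le_mul _ hyt _ hx
    rw [Real.dist_eq, Real.dist_eq, abs_sub_comm (y t), ← he] at h4
    have h5 : r / n + Δ = (r + 2 * rhs K (isolatedFraction G)) / n +
        (2 / n) * (rhs K (y t) - rhs K (isolatedFraction G)) + (Δ - 2 / n * rhs K (y t)) := by
      ring
    calc |r / n + Δ| ≤ |(r + 2 * rhs K (isolatedFraction G)) / n| +
          |(2 / n) * (rhs K (y t) - rhs K (isolatedFraction G))| + |Δ - 2 / n * rhs K (y t)| := by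
          rw [h5]
          exact abs_add_three _ _ _
      _ ≤ c / n / n + 2 / n * (L * |e|) + L * L * (2 / n) ^ 2 := by
          rw [abs_div, abs_mul, abs_of_pos hn0', abs_of_pos (by positivity : 0 < 2 / (n : ℝ))]
          gcongr
      _ = _ := by field_simp; ring

/-- The mean square deviation from the solution is of order `1 / n`. -/
lemma exists_integral_sq_le {K : ℝ≥0} (hK : 0 < K) {C : ℝ} (hC : 0 ≤ C) {y : ℝ → ℝ}
    (h0 : y 0 = 1) (hI : ∀ t, 0 ≤ t → y t ∈ Icc (0 : ℝ) 1)
    (hd : ∀ t, 0 ≤ t → HasDerivWithinAt y (rhs K (y t)) (Ici 0) t) :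
    ∃ b : ℝ, 0 ≤ b ∧ ∃ n₀ : ℕ, ∀ n : ℕ, n₀ ≤ n → ∀ m : ℕ, (m : ℝ) ≤ C * n →
      ∫ ω, (isolatedFraction (ω m) - y (2 * m / n)) ^ 2 ∂processLaw n K ≤ b / n := by
  obtain ⟨a, b, ha, hb, n₀, h⟩ := exists_one_step_bound hK hC hI hd
  refine ⟨b * C * Real.exp (a * C), by positivity, n₀, fun n hn => ?_⟩
  obtain ⟨hn0, hstep⟩ := h n hn
  have hn0' : (0 : ℝ) < n := by exact_mod_cast hn0
  have hint : ∀ f : SimpleGraph (Fin n) → ℝ, ∀ m : ℕ,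
      Integrable (fun ω => f (ω m)) (processLaw n K) := by
    intro f m
    have h1 : Integrable f ((processLaw n K).map fun ω => ω m) :=
      haveI : IsFiniteMeasure ((processLaw n K).map fun ω => ω m) := inferInstance
      .of_finite
    exact h1.comp_measurable (by fun_prop)
  -- Discrete Grönwall: each step adds `b / n ^ 2`, later amplified by at most `(1 + a / n) ^ m`.
  have key : ∀ m : ℕ, (m : ℝ) ≤ C * n →
      ∫ ω, (isolatedFraction (ω m) - y (2 * m / n)) ^ 2 ∂processLaw n K ≤
        b / n ^ 2 * m * (1 + a / n) ^ m := by
    intro m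
    induction m with
    | zero =>
      intro _
      have h1 : ∀ᵐ ω ∂processLaw n K,
          (isolatedFraction (ω 0) - y (2 * (0 : ℕ) / n)) ^ 2 = 0 := by
        filter_upwards [ae_init] with ω hω
        rw [hω, isolatedFraction, ncard_isolatedSet_bot, div_self hn0'.ne']
        simp [h0]
      rw [integral_congr_ae h1]
      simp
    | succ m ih =>
      intro hm
      have hm' : (m : ℝ) ≤ C * n := by
        push_cast at hm
        linarith
      have ih := ih hm'
      rw [integral_succ m (fun G => (isolatedFraction G - y (2 * (m + 1 : ℕ) / n)) ^ 2)]
      have h1 : (1 : ℝ) ≤ 1 + a / n := by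
        have : 0 ≤ a / n := by positivity
        linarith
      calc _ ≤ ∫ ω, ((1 + a / n) * (isolatedFraction (ω m) - y (2 * m / n)) ^ 2 + b / n ^ 2)
            ∂processLaw n K := by
            refine integral_mono_ae (hint (fun G => ∫ H, (isolatedFraction H -
              y (2 * (m + 1 : ℕ) / n)) ^ 2 ∂(stepLaw K G).toMeasure) m)
              (hint (fun G => (1 + a / n) * (isolatedFraction G - y (2 * m / n)) ^ 2 +
                b / n ^ 2) m) ?_
            filter_upwards [ae_ncard_edgeSet_le] with ω hω
            exact hstep (ω m) m (le_trans (by exact_mod_cast hω m) hm')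
        _ = (1 + a / n) * ∫ ω, (isolatedFraction (ω m) - y (2 * m / n)) ^ 2 ∂processLaw n K +
            b / n ^ 2 := by
            rw [integral_add ((hint (fun G => (isolatedFraction G - y (2 * m / n)) ^ 2)
              m).const_mul _) (integrable_const _), integral_const_mul, integral_const]
            simp
        _ ≤ (1 + a / n) * (b / n ^ 2 * m * (1 + a / n) ^ m) +
            b / n ^ 2 * (1 + a / n) ^ (m + 1) := by
            gcongr
            exact le_mul_of_one_le_right (by positivity) (one_le_pow₀ h1)
        _ = _ := by
            push_cast
            ring
  intro m hm
  refine (key m hm).trans ?_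
  have h2 : (1 + a / n) ^ m ≤ Real.exp (a * C) := by
    calc (1 + a / n) ^ m ≤ Real.exp (a / n) ^ m := by
          gcongr
          rw [add_comm]
          exact Real.add_one_le_exp _
      _ = Real.exp (m * (a / n)) := (Real.exp_nat_mul _ _).symm
      _ ≤ Real.exp (C * n * (a / n)) := by gcongr
      _ = _ := by
          congr 1
          field_simp
  calc _ ≤ b / n ^ 2 * (C * n) * Real.exp (a * C) := by gcongr
    _ = _ := by field_simp

/-! ### From mean squares to uniform closeness -/

/-- Events whose complements are almost surely contained in events of small probability. -/
lemma tendsto_processLaw_one {K : ℝ≥0} {S B : ∀ n : ℕ, Set (ℕ → SimpleGraph (Fin n))}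
    {r : ℕ → ℝ} (hr : Tendsto r atTop (𝓝 0))
    (hS : ∀ᶠ n in atTop, ∀ᵐ ω ∂processLaw n K, ω ∉ B n → ω ∈ S n)
    (hB : ∀ᶠ n in atTop, processLaw n K (B n) ≤ ENNReal.ofReal (r n)) :
    Tendsto (fun n => processLaw n K (S n)) atTop (𝓝 1) := by
  have h1 : Tendsto (fun n => 1 - ENNReal.ofReal (r n)) atTop (𝓝 1) := by
    have h2 := ENNReal.Tendsto.sub (tendsto_const_nhds (x := (1 : ℝ≥0∞)) (f := atTop))
      (ENNReal.tendsto_ofReal hr) (Or.inl ENNReal.one_ne_top)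
    simpa using h2
  refine tendsto_of_tendsto_of_tendsto_of_le_of_le' h1 tendsto_const_nhds ?_
    (Eventually.of_forall fun n => prob_le_one)
  filter_upwards [hS, hB] with n hSn hBn
  rw [tsub_le_iff_right]
  -- Subadditivity of the outer measure suffices, so `S n` need not be measurable.
  calc (1 : ℝ≥0∞) = processLaw n K univ := measure_univ.symm
    _ ≤ processLaw n K (S n ∪ B n) := by
      refine measure_mono_ae ?_
      filter_upwards [hSn] with ω hω _
      by_cases hb : ω ∈ B n
      · exact Or.inr hb
      · exact Or.inl (hω hb)
    _ ≤ processLaw n K (S n) + processLaw n K (B n) := measure_union_le _ _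
    _ ≤ _ := by gcongr

/-- The process is deterministic here; the constant `2` pays for rounding `t * n / 2` down, as
$2/n\le 2n^{-1/4}$. -/
lemma almostSurelyClose_zero : AlmostSurelyClose 0 1 (fun t => 1 - t) := by
  refine ⟨2, tendsto_processLaw_one (B := fun _ => ∅) (r := fun _ => 0) tendsto_const_nhds ?_
    (by simp)⟩
  filter_upwards [eventually_ge_atTop 1] with n hn
  have hn' : (1 : ℝ) ≤ n := by exact_mod_cast hn
  have hn0 : (0 : ℝ) < n := by linarith
  filter_upwards [ae_ncard_isolatedSet_zero] with ω hω _ t ht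
  obtain ⟨ht0, ht1⟩ := ht
  have h0 : 0 ≤ t * n / 2 := by positivity
  have h1 : (⌊t * n / 2⌋₊ : ℝ) ≤ t * n / 2 := Nat.floor_le h0
  have h2 : t * n / 2 < ⌊t * n / 2⌋₊ + 1 := Nat.lt_floor_add_one _
  have h3 : 2 * ⌊t * n / 2⌋₊ ≤ n := by
    have : (2 : ℝ) * ⌊t * n / 2⌋₊ ≤ n := by nlinarith
    exact_mod_cast this
  have h4 : ((isolatedSet (ω ⌊t * n / 2⌋₊)).ncard : ℝ) = n - 2 * ⌊t * n / 2⌋₊ := by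
    rw [eq_sub_iff_add_eq]
    exact_mod_cast hω _ h3
  have h5 : (n : ℝ) ^ (-1 : ℝ) ≤ (n : ℝ) ^ (-(1 / 4) : ℝ) :=
    Real.rpow_le_rpow_of_exponent_le hn' (by norm_num)
  rw [Real.rpow_neg_one] at h5
  have h6 : isolatedFraction (atTime ω t) - (1 - t) = (t * n - 2 * ⌊t * n / 2⌋₊) * (n : ℝ)⁻¹ := by
    rw [isolatedFraction, atTime, h4]
    field_simp
    ring
  rw [h6, abs_mul, abs_of_pos (inv_pos.2 hn0)]
  gcongr
  rw [abs_le]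
  constructor <;> linarith

/-- Between two grid points of the time axis the isolated fraction stays close to the solution. -/
lemma abs_isolatedFraction_sub_le {n : ℕ} {q L t : ℝ} {g : ℕ} {y : ℝ → ℝ}
    {ω : ℕ → SimpleGraph (Fin n)} (hq : 0 < q) (hqn : q ^ 4 = n) (hg0 : 0 < g)
    (hg : (g : ℝ) ≤ 2 * q ^ 3) (hL : 0 ≤ L) (ht : 0 ≤ t)
    (hy : ∀ s, 0 ≤ s → s ≤ t → |y t - y s| ≤ L * (t - s))
    (hω : ∀ m k, (isolatedSet (ω (m + k))).ncard ≤ (isolatedSet (ω m)).ncard ∧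
      (isolatedSet (ω m)).ncard ≤ (isolatedSet (ω (m + k))).ncard + 2 * k)
    (hgrid : |isolatedFraction (ω (⌊t * n / 2⌋₊ / g * g)) -
      y (2 * (⌊t * n / 2⌋₊ / g * g : ℕ) / n)| ≤ q⁻¹) :
    |isolatedFraction (atTime ω t) - y t| ≤ (5 + 4 * L) * q⁻¹ := by
  have hn0 : (0 : ℝ) < n := by rw [← hqn]; positivity
  rw [atTime]
  have h0 : 0 ≤ t * n / 2 := by positivity
  have h1 : (⌊t * n / 2⌋₊ : ℝ) ≤ t * n / 2 := Nat.floor_le h0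
  have h2 : t * n / 2 < ⌊t * n / 2⌋₊ + 1 := Nat.lt_floor_add_one _
  set m := ⌊t * n / 2⌋₊ with hm
  set m₀ := m / g * g with hm₀
  have hdiv : m₀ + m % g = m := Nat.div_add_mod' m g
  have hmod : m % g < g := Nat.mod_lt _ hg0
  have hdiv' : (m₀ : ℝ) + (m % g : ℕ) = m := by exact_mod_cast hdiv
  -- The `+ 1` absorbs the floor, so `t` too lies within `2 * g / n` of the grid time.
  have hmod' : ((m % g : ℕ) : ℝ) + 1 ≤ g := by exact_mod_cast hmod
  have hgn : 2 * (g : ℝ) / n ≤ 4 * q⁻¹ := by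
    calc 2 * (g : ℝ) / n ≤ 2 * (2 * q ^ 3) / n := by gcongr
      _ = 4 * q⁻¹ := by rw [← hqn]; field_simp; norm_num
  have h3 : |isolatedFraction (ω m) - isolatedFraction (ω m₀)| ≤ 4 * q⁻¹ := by
    obtain ⟨h4, h5⟩ := hω m₀ (m % g)
    rw [hdiv] at h4 h5
    have h4' : ((isolatedSet (ω m)).ncard : ℝ) ≤ (isolatedSet (ω m₀)).ncard := by
      exact_mod_cast h4
    have h5' : ((isolatedSet (ω m₀)).ncard : ℝ) ≤
        (isolatedSet (ω m)).ncard + 2 * (m % g : ℕ) := by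
      exact_mod_cast h5
    refine le_trans ?_ hgn
    rw [isolatedFraction, isolatedFraction, ← sub_div, abs_div, abs_of_pos hn0]
    gcongr
    rw [abs_le]
    constructor <;> linarith
  have hs : 2 * (m₀ : ℝ) / n ≤ t := by
    rw [div_le_iff₀ hn0]
    have : (0 : ℝ) ≤ (m % g : ℕ) := Nat.cast_nonneg _
    linarith
  have h6 : |y (2 * m₀ / n) - y t| ≤ L * (4 * q⁻¹) := by
    rw [abs_sub_comm]
    refine (hy _ (by positivity) hs).trans ?_
    gcongr
    refine le_trans ?_ hgn
    rw [sub_le_iff_le_add, ← add_div, le_div_iff₀ hn0]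
    linarith
  calc |isolatedFraction (ω m) - y t| = |(isolatedFraction (ω m) - isolatedFraction (ω m₀)) +
        (isolatedFraction (ω m₀) - y (2 * m₀ / n)) + (y (2 * m₀ / n) - y t)| := by
        congr 1
        ring
    _ ≤ _ := abs_add_three _ _ _
    _ ≤ 4 * q⁻¹ + q⁻¹ + L * (4 * q⁻¹) := by gcongr
    _ = _ := by ring

lemma almostSurelyClose_of_hasDerivWithinAt {K : ℝ≥0} (hK : 0 < K) {C : ℝ} (hC : 0 < C)
    {y : ℝ → ℝ} (h0 : y 0 = 1) (hI : ∀ t, 0 ≤ t → y t ∈ Icc (0 : ℝ) 1)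
    (hd : ∀ t, 0 ≤ t → HasDerivWithinAt y (rhs K (y t)) (Ici 0) t) :
    AlmostSurelyClose K C y := by
  have hK' : (0 : ℝ) < K := hK
  obtain ⟨L, hL⟩ := exists_lipschitz_rhs hK'
  obtain ⟨b, hb, n₀, hsq⟩ := exists_integral_sq_le hK hC.le h0 hI hd
  -- With $q=n^{1/4}$, a grid spacing of about $q^3$ steps changes the isolated fraction by
  -- $O(1/q)$.
  set q : ℕ → ℝ := fun n => (n : ℝ) ^ (1 / 4 : ℝ) with hq
  set g : ℕ → ℕ := fun n => ⌈q n ^ 3⌉₊ with hg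
  set dev : ∀ n : ℕ, ℕ → (ℕ → SimpleGraph (Fin n)) → ℝ := fun n m ω =>
    isolatedFraction (ω m) - y (2 * m / n) with hdev
  have hqn : ∀ n : ℕ, q n ^ 4 = n := by
    intro n
    simp only [hq]
    rw [← Real.rpow_natCast, ← Real.rpow_mul (Nat.cast_nonneg n)]
    norm_num
  have hq1 : ∀ n : ℕ, 1 ≤ n → 1 ≤ q n := fun n hn =>
    Real.one_le_rpow (by exact_mod_cast hn) (by norm_num)
  have hqtop : Tendsto q atTop atTop :=
    (tendsto_rpow_atTop (by norm_num)).comp tendsto_natCast_atTop_atTop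
  -- Union bound: at most `C * q n + 1` grid points, each failing with probability at most
  -- $(b/n)q^2=b/q^2$.
  have hr : Tendsto (fun n => (C * q n + 1) * (b / q n ^ 2)) atTop (𝓝 0) := by
    have h1 : Tendsto (fun n => (q n)⁻¹) atTop (𝓝 0) := tendsto_inv_atTop_zero.comp hqtop
    have h2 : Tendsto (fun n => C * b * (q n)⁻¹ + b * (q n)⁻¹ ^ 2) atTop (𝓝 0) := by
      simpa using (h1.const_mul (C * b)).add ((h1.pow 2).const_mul b)
    refine h2.congr' ?_
    filter_upwards [eventually_ge_atTop 1] with n hn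
    have : q n ≠ 0 := (one_pos.trans_le (hq1 n hn)).ne'
    field_simp
  refine ⟨5 + 4 * L, tendsto_processLaw_one (B := fun n => ⋃ j ∈
    (Finset.range (⌊C * q n⌋₊ + 1)).filter (fun j => ((j * g n : ℕ) : ℝ) ≤ C * n),
    {ω | (q n)⁻¹ ^ 2 ≤ dev n (j * g n) ω ^ 2}) hr ?_ ?_⟩
  · filter_upwards [eventually_ge_atTop 1] with n hn
    have hq0 : 0 < q n := one_pos.trans_le (hq1 n hn)
    have hn0 : (0 : ℝ) < n := by exact_mod_cast hn
    filter_upwards [ae_ncard_isolatedSet] with ω hω hbad t ht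
    obtain ⟨ht0, htC⟩ := ht
    have hg1 : q n ^ 3 ≤ g n := Nat.le_ceil _
    have hg0 : 0 < g n := Nat.ceil_pos.2 (by positivity)
    have hg2 : (g n : ℝ) ≤ 2 * q n ^ 3 := by
      have h1 : (g n : ℝ) < q n ^ 3 + 1 := Nat.ceil_lt_add_one (by positivity)
      have h2 : 1 ≤ q n ^ 3 := one_le_pow₀ (hq1 n hn)
      linarith
    have hqeq : (n : ℝ) ^ (-(1 / 4) : ℝ) = (q n)⁻¹ := Real.rpow_neg (Nat.cast_nonneg n) _
    rw [hqeq]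
    refine abs_isolatedFraction_sub_le hq0 (hqn n) hg0 hg2 L.2 ht0
      (fun s hs hst => (abs_solution_sub_le hK' hL hI hd hs hst).1) hω ?_
    have hfl : (⌊t * n / 2⌋₊ : ℝ) ≤ t * n / 2 := Nat.floor_le (by positivity)
    set m := ⌊t * n / 2⌋₊ with hm
    have hmC : (m : ℝ) ≤ C * n := by nlinarith
    have hm₀ : ((m / g n * g n : ℕ) : ℝ) ≤ m := by exact_mod_cast Nat.div_mul_le_self m (g n)
    have hj : m / g n < ⌊C * q n⌋₊ + 1 := by
      rw [Nat.lt_succ_iff]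
      refine Nat.le_floor ?_
      have h3 : ((m / g n : ℕ) : ℝ) * q n ^ 3 ≤ C * q n * q n ^ 3 := by
        calc ((m / g n : ℕ) : ℝ) * q n ^ 3 ≤ ((m / g n : ℕ) : ℝ) * g n := by gcongr
          _ ≤ C * n := by
            rw [← Nat.cast_mul]
            exact hm₀.trans hmC
          _ = _ := by rw [← hqn n]; ring
      exact le_of_mul_le_mul_right h3 (by positivity)
    simp only [mem_iUnion, not_exists, Finset.mem_filter, Finset.mem_range, and_imp] at hbad
    have h4 := hbad (m / g n) hj (hm₀.trans hmC)
    rw [Set.mem_ofPred_eq, not_le] at h4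
    exact (abs_lt_of_sq_lt_sq h4 (by positivity)).le
  · filter_upwards [eventually_ge_atTop 1, eventually_ge_atTop n₀] with n hn hn₀
    have hq0 : 0 < q n := one_pos.trans_le (hq1 n hn)
    have hj : ∀ j : ℕ, ((j * g n : ℕ) : ℝ) ≤ C * n →
        processLaw n K {ω | (q n)⁻¹ ^ 2 ≤ dev n (j * g n) ω ^ 2} ≤
          ENNReal.ofReal (b / q n ^ 2) := by
      intro j hjC
      have hint : Integrable (fun ω => dev n (j * g n) ω ^ 2) (processLaw n K) := by
        have h1 : Integrable (fun G => (isolatedFraction G - y (2 * (j * g n : ℕ) / n)) ^ 2)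
            ((processLaw n K).map fun ω => ω (j * g n)) := .of_finite
        exact h1.comp_measurable (by fun_prop)
      have h2 := mul_meas_ge_le_integral_of_nonneg (μ := processLaw n K)
        (ae_of_all _ fun ω => sq_nonneg (dev n (j * g n) ω)) hint ((q n)⁻¹ ^ 2)
      have h3 := h2.trans (hsq n hn₀ _ hjC)
      rw [← ENNReal.ofReal_toReal (measure_ne_top (processLaw n K) _)]
      refine ENNReal.ofReal_le_ofReal ?_
      change (processLaw n K).real _ ≤ _
      refine ((le_div_iff₀' (by positivity)).2 h3).trans (le_of_eq ?_)
      rw [← hqn n]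
      field_simp
    refine (measure_biUnion_finset_le _ _).trans ((Finset.sum_le_card_nsmul _ _ _
      fun j hjm => hj j (Finset.mem_filter.1 hjm).2).trans ?_)
    rw [nsmul_eq_mul, ← ENNReal.ofReal_natCast, ← ENNReal.ofReal_mul (Nat.cast_nonneg _)]
    refine ENNReal.ofReal_le_ofReal ?_
    gcongr
    calc (((Finset.range (⌊C * q n⌋₊ + 1)).filter
          (fun j => ((j * g n : ℕ) : ℝ) ≤ C * n)).card : ℝ) ≤ ((⌊C * q n⌋₊ + 1 : ℕ) : ℝ) := by
          refine Nat.cast_le.2 ((Finset.card_filter_le _ _).trans ?_)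
          rw [Finset.card_range]
      _ ≤ _ := by
          push_cast
          gcongr
          exact Nat.floor_le (by positivity)

end BiasedProcess

end

open BiasedProcess in
theorem theorem1 :
    (∀ K : ℝ≥0, 0 < K → ∃ y : ℝ → ℝ,
      (∀ T : ℝ, 0 < T → IsUniqueSolution K T y) ∧
      ∀ C : ℝ, 0 < C → AlmostSurelyClose K C y) ∧
    (∃ y : ℝ → ℝ, IsUniqueSolution 0 1 y ∧ AlmostSurelyClose 0 1 y) := by
  refine ⟨fun K hK => ?_, fun t => 1 - t, isUniqueSolution_zero, almostSurelyClose_zero⟩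
  obtain ⟨y, h0, hI, hd⟩ := exists_solution (NNReal.coe_pos.2 hK)
  exact ⟨y, fun T hT => isUniqueSolution_of_hasDerivWithinAt (NNReal.coe_pos.2 hK) hT h0 hI hd,
    fun C hC => almostSurelyClose_of_hasDerivWithinAt hK hC h0 hI hd⟩
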